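/- **Conventions.** Fix a countable first-order language $L$. A \emph{map} $f:M\to N$ between $L$-structures is a triple consisting of $M$, $N$ and an injective function $f$ with $\operatorname{dom} f\subseteq M$ and $\operatorname{rng} f\subseteq N$; it is \emph{total} if $\operatorname{dom} f=M$, $|f|$ denotes the cardinality of $\operatorname{dom} f$, and $f^{-1}:N\to M$ is the inverse map. A map $f:M\to N$ is a \emph{partial embedding} (resp. \emph{elementary}) if $M\models\varphi(a)\Leftrightarrow N\models\varphi(fa)$ for every quantifier-free formula (resp. every formula) $\varphi(x)$ and every finite (possibly empty) tuple $a$ from $\operatorname{dom} f$. An \emph{inductive amalgamation class} $\mathcal K$ is a category whose objects, called \emph{models}, are infinite $L$-structures, whose morphisms are partial embeddings between models, composed as maps, such that: (K0) models are closed under elementary equivalence; (K1) all elementary maps between models are morphisms; (K2) the inverse of a morphism is a morphism; (R) if $h:M\to N$ is a morphism and $f\subseteq h$, then $f:M\to N$ is a morphism; (Ap) for every morphism $f:M\to N$ there are a model $N'$ with $N\le N'$ and a total morphism $h:M\to N'$ with $f\subseteq h$; (In) the union $M$ of a nonempty well-ordered chain of models $\langle M_i\rangle$ with $M_i\le M_j$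 for $i<j$ is a model, and $M_i\le M$ for all $i$. Here $M\le N$ means that $M$ is a substructure of $N$ and the inclusion $\mathrm{id}_M:M\to N$ is a morphism. For an infinite cardinal $\lambda$, a model $U$ is \emph{$\lambda$-rich} if every morphism $f:M\to U$ with $|f|<|M|\le\lambda$ extends to a total morphism $M\to U$; it is \emph{rich} if it is $|U|$-rich. A structure $M$ is \emph{$\lambda$-saturated} if every set of formulas in finitely many variables, with parameters from a subset of $M$ of cardinality $<\lambda$, that is finitely satisfiable in $M$ is realized in $M$; it is \emph{saturated} if it is $|M|$-saturated. $T_{\rm rich}$ is the set of sentences that hold in every rich model. $\mathcal K$ is \emph{full} if for every model $M$: if each sentence true in $M$ is true in some rich model, then some rich model satisfies $\mathrm{Th}(M)$. It is assumed that there are arbitrarily large (strongly) inaccessible cardinals. **Theorem.** Let $\mathcal K$ be a full inductive amalgamation class and let $\lambda$ be an infinite cardinal. The following are equivalent: 1. all rich models are saturated; 2. all $\lambda$-rich models are $\lambda$-saturated; 3. all saturated models $M\models T_{\rm rich}$ are rich; 4. all morphisms between models $M,N\models T_{\rm rich}$ are elementary; 5. $M\le N\Leftrightarrow M\preceq N$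 for all models $M,N\models T_{\rm rich}$ with $M$ a substructure of $N$. (Since $\lambda$ is arbitrary, these are also equivalent to: for every infinite cardinal $\lambda$, all $\lambda$-rich models are $\lambda$-saturated.) -/

import Mathlib

universe u v w

open FirstOrder FirstOrder.Language Cardinal

noncomputable section

namespace PartialMap

/-! A map `f : M → N` is a triple consisting of its domain `M`, its co-domain `N` and a function
with domain of definition contained in `M` and range contained in `N`. All maps used here are
injective, so they are elements of `M ≃. N`: composition is `PEquiv.trans`, the inverse is
`PEquiv.symm`, and `f ⊆ h` is `f ≤ h`. -/

variable {L : FirstOrder.Language.{v, w}} {M N : Type u} [L.Structure M] [L.Structure N]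

/-- The domain of definition. Since maps are functions, `|f|` is the cardinality of this set. -/
def dom {M N : Type u} (f : M ≃. N) : Set M := {a | ∃ b, f a = some b}

/-- The map is defined on the whole of its domain. -/
def IsTotal {M N : Type u} (f : M ≃. N) : Prop := ∀ a, ∃ b, f a = some b

variable (L) in
/-- Quantifier-free formulas are preserved, in both directions, on tuples from `dom f`.
The empty tuple is allowed. -/
def IsPartialEmbedding (f : M ≃. N) : Prop :=
  ∀ (n : ℕ) (φ : L.Formula (Fin n)), BoundedFormula.IsQF φ →
    ∀ (a : Fin n → M) (b : Fin n → N), (∀ i, f (a i) = some (b i)) →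
      (φ.Realize a ↔ φ.Realize b)

variable (L) in
/-- All formulas are preserved, in both directions, on tuples from `dom f`.
The empty tuple is allowed. -/
def IsElementaryMap (f : M ≃. N) : Prop :=
  ∀ (n : ℕ) (φ : L.Formula (Fin n)) (a : Fin n → M) (b : Fin n → N),
    (∀ i, f (a i) = some (b i)) → (φ.Realize a ↔ φ.Realize b)

/-- An embedding of structures, regarded as a (total) map. -/
def ofEmbedding (e : M ↪[L] N) : M ≃. N where
  toFun a := some (e a)
  invFun := Function.partialInv e
  inv a b := by
    rw [e.injective.isPartialInv a b, Option.some_inj]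

end PartialMap

open PartialMap

/-- An inductive amalgamation class of `L`-structures. -/
structure InductiveAmalgamationClass (L : FirstOrder.Language.{v, w}) where
  /-- The objects, called models. -/
  Obj : ∀ (M : Type u) [L.Structure M], Prop
  /-- The morphisms. -/
  Mor : ∀ {M N : Type u} [L.Structure M] [L.Structure N], (M ≃. N) → Prop
  infinite_of_obj : ∀ {M : Type u} [L.Structure M], Obj M → Infinite M
  /-- Domain and co-domain of a morphism are objects. -/
  obj_of_mor : ∀ {M N : Type u} [L.Structure M] [L.Structure N] {f : M ≃. N},
    Mor f → Obj M ∧ Obj N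
  isPartialEmbedding_of_mor : ∀ {M N : Type u} [L.Structure M] [L.Structure N] {f : M ≃. N},
    Mor f → IsPartialEmbedding L f
  /-- Morphisms compose. (Identities are morphisms by `K1`.) -/
  comp : ∀ {M N P : Type u} [L.Structure M] [L.Structure N] [L.Structure P]
    {f : M ≃. N} {g : N ≃. P}, Mor f → Mor g → Mor (f.trans g)
  /-- Models are closed under elementary equivalence. -/
  K0 : ∀ {M N : Type u} [L.Structure M] [L.Structure N], Obj M → M ≅[L] N → Obj N
  /-- All elementary maps between models are morphisms. -/
  K1 : ∀ {M N : Type u} [L.Structure M] [L.Structure N] {f : M ≃. N},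
    Obj M → Obj N → IsElementaryMap L f → Mor f
  /-- The inverse of a morphism is a morphism. -/
  K2 : ∀ {M N : Type u} [L.Structure M] [L.Structure N] {f : M ≃. N}, Mor f → Mor f.symm
  /-- Restrictions of morphisms are morphisms. -/
  R : ∀ {M N : Type u} [L.Structure M] [L.Structure N] {f h : M ≃. N}, Mor h → f ≤ h → Mor f
  /-- Amalgamation: every morphism `f : M → N` extends to a strong embedding `h : M → N'` for some
  strong extension `j` of `N` to `N'` (strong extensions are given up to isomorphism). -/
  Ap : ∀ {M N : Type u} [L.Structure M] [L.Structure N] {f : M ≃. N}, Mor f →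
    ∃ (N' : Type u) (_ : L.Structure N') (j : N ≃. N') (h : M ≃. N'),
      (Mor j ∧ IsTotal j) ∧ (Mor h ∧ IsTotal h) ∧ f.trans j ≤ h
  /-- Unions of nonempty well-ordered chains: `M` is the union of the chain of the `S i`. -/
  In : ∀ {M : Type u} [L.Structure M] {ι : Type u} [LinearOrder ι] [WellFoundedLT ι] [Nonempty ι]
    (S : ι → L.Substructure M), (∀ i, Obj (S i)) →
    (∀ i j, i < j → ∃ hij : S i ≤ S j, Mor (ofEmbedding (Substructure.inclusion hij))) →
    (∀ x : M, ∃ i, x ∈ S i) →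
    Obj M ∧ ∀ i, Mor (ofEmbedding (S i).subtype)

namespace InductiveAmalgamationClass

variable {L : FirstOrder.Language.{v, w}} (K : InductiveAmalgamationClass.{u, v, w} L)

/-- A strong embedding is a total morphism. -/
def IsStrongEmbedding {M N : Type u} [L.Structure M] [L.Structure N] (f : M ≃. N) : Prop :=
  K.Mor f ∧ IsTotal f

/-- `S ≤ N`: the substructure `S` of `N` is a strong submodel. -/
def IsStrongSubmodel {N : Type u} [L.Structure N] (S : L.Substructure N) : Prop :=
  K.Mor (ofEmbedding S.subtype)

/-- `U` is a `κ`-rich model. -/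
def IsRichAt (κ : Cardinal.{u}) (U : Type u) [L.Structure U] : Prop :=
  K.Obj U ∧ ∀ (M : Type u) [L.Structure M] (f : M ≃. U),
    K.Mor f → #(dom f) < #M → #M ≤ κ → ∃ h : M ≃. U, K.IsStrongEmbedding h ∧ f ≤ h

/-- `U` is a rich model. -/
def IsRich (U : Type u) [L.Structure U] : Prop := K.IsRichAt #U U

/-- `T_rich`, the set of the sentences that hold in every rich model. -/
def richTheory : L.Theory :=
  {φ | ∀ (U : Type u) [L.Structure U], K.IsRich U → U ⊨ φ}

/-- `M` is a model (an object of the class) in which `T_rich` holds. -/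
def IsRichTheoryModel (M : Type u) [L.Structure M] : Prop :=
  K.Obj M ∧ M ⊨ K.richTheory

/-- If each sentence true in a model `M` is true in some rich model, then some rich model satisfies
the complete theory of `M`. -/
def IsFull : Prop :=
  ∀ (M : Type u) [L.Structure M], K.Obj M →
    (∀ φ : L.Sentence, M ⊨ φ → ∃ (U : Type u) (_ : L.Structure U), K.IsRich U ∧ U ⊨ φ) →
    ∃ (U : Type u) (_ : L.Structure U), K.IsRich U ∧ U ⊨ L.completeTheory M

end InductiveAmalgamationClass

/-- `M` is `κ`-saturated: a set of formulas in finitely many variables, with parameters from a set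
`A ⊆ M` of cardinality less than `κ`, is realized in `M` as soon as it is finitely satisfiable
in `M`. -/
def IsSaturatedAt (L : FirstOrder.Language.{v, w}) (κ : Cardinal.{u}) (M : Type u) [L.Structure M] : Prop :=
  ∀ A : Set M, #A < κ → ∀ (n : ℕ) (p : Set (L[[A]].Formula (Fin n))),
    (∀ q : Set (L[[A]].Formula (Fin n)), q ⊆ p → q.Finite →
      ∃ x : Fin n → M, ∀ φ ∈ q, φ.Realize x) →
    ∃ x : Fin n → M, ∀ φ ∈ p, φ.Realize x

/-- `M` is saturated. -/
def IsSaturated (L : FirstOrder.Language.{v, w}) (M : Type u) [L.Structure M] : Prop :=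
  IsSaturatedAt L #M M

end

/-! Everything passes through statement 4. The engine is that morphisms between rich models are
always elementary. By Löwenheim–Skolem, a morphism with finite domain into a rich model extends to
any further point, since domain and point lie in a countable elementary substructure. Back and forth
does the rest (`isElementaryMap_of_hasFiniteExtension`).

Rich models are plentiful: for inaccessible `μ`, a chain of length `μ` that solves all small
extension problems gives a model of size `μ` into which every morphism from a smaller model extends
(`exists_isWeaklyRichAt`). Such a `U` is rich. To extend a map defined on a model of size up to `μ`,
embed that model in a similar `V`. Morphisms `V → U` are elementary, and elementary maps extend
point by point. This detour matters because unions of chains of elementary maps are elementary,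
while no axiom makes unions of chains of morphisms morphisms.

Given 4, a type over a small subset of a rich model is realized in an elementary extension, and a
substructure containing the parameters and the realization is mapped back by richness. The map is
elementary by 4, so the type is realized. This gives 1 and 2. For 3, embed the source of a morphism
into a rich model. The induced map into the saturated model is elementary by 4, and saturation
extends it. Statement 5 is immediate from 4.

Conversely, to show that a morphism `f : M → N` is elementary it is enough to send each finite tuple
of `M` and of `N` elementarily into a rich model and use the engine
(`isElementaryMap_of_isFinitelyRichlyEmbeddable`). Under 1 or 2 fullness provides an elementarily
equivalent rich model that is saturated enough. Under 3 a saturated elementary extension is rich.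
Such extensions come from the same construction applied to `elementaryClass`. Under 5, `M` and `N`
are amalgamated over `f` inside a rich model, and both embeddings are elementary. -/

namespace PartialMap

/-! ### Partial injective maps: graphs, restrictions, domains -/

section Basic

variable {M N P : Type u}

theorem le_iff {f g : M ≃. N} : f ≤ g ↔ ∀ a b, f a = some b → g a = some b :=
  Iff.rfl.trans ⟨fun h a b => h a b, fun h a b => h a b⟩

/-- The partial map with a given functional and injective graph. -/
noncomputable def ofGraph (G : M → N → Prop) (hf : ∀ a b c, G a b → G a c → b = c)
    (hi : ∀ a b c, G a c → G b c → a = b) : M ≃. N where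
  toFun a := open Classical in if h : ∃ b, G a b then some h.choose else none
  invFun b := open Classical in if h : ∃ a, G a b then some h.choose else none
  inv a b := by
    constructor
    · intro h
      split_ifs at h with h'
      obtain rfl := Option.some_injective _ h
      have h2 : ∃ c, G h'.choose c := ⟨b, h'.choose_spec⟩
      rw [dif_pos h2, hf _ _ _ h2.choose_spec h'.choose_spec]
    · intro h
      split_ifs at h with h'
      obtain rfl := Option.some_injective _ h
      have h2 : ∃ c, G c h'.choose := ⟨a, h'.choose_spec⟩
      rw [dif_pos h2, hi _ _ _ h2.choose_spec h'.choose_spec]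

theorem ofGraph_eq_some {G : M → N → Prop} {hf hi} {a : M} {b : N} :
    ofGraph G hf hi a = some b ↔ G a b := by
  change (open Classical in if h : ∃ b, G a b then some h.choose else none) = some b ↔ _
  constructor
  · intro h
    split_ifs at h with h'
    obtain rfl := Option.some_injective _ h
    exact h'.choose_spec
  · intro h
    have h' : ∃ b, G a b := ⟨b, h⟩
    rw [dif_pos h', hf _ _ _ h'.choose_spec h]

/-- The restriction of a partial map to a set. -/
noncomputable def restrict (f : M ≃. N) (s : Set M) : M ≃. N :=
  ofGraph (fun a b => a ∈ s ∧ f a = some b)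
    (fun _ _ _ h h' => Option.some_injective _ (h.2.symm.trans h'.2))
    (fun _ _ _ h h' => f.inj h.2 h'.2)

theorem restrict_eq_some {f : M ≃. N} {s : Set M} {a : M} {b : N} :
    restrict f s a = some b ↔ a ∈ s ∧ f a = some b := ofGraph_eq_some

theorem restrict_le (f : M ≃. N) (s : Set M) : restrict f s ≤ f :=
  le_iff.2 fun _ _ h => (restrict_eq_some.1 h).2

theorem dom_restrict_subset (f : M ≃. N) (s : Set M) : dom (restrict f s) ⊆ s :=
  fun _ ⟨_, h⟩ => (restrict_eq_some.1 h).1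

theorem mk_dom_symm_le (f : M ≃. N) : #(dom f.symm) ≤ #(dom f) :=
  Cardinal.mk_le_of_injective
    (f := fun b : dom f.symm => (⟨b.2.choose, b, f.eq_some_iff.1 b.2.choose_spec⟩ : dom f))
    fun b c h => by
      have hb := f.eq_some_iff.1 b.2.choose_spec
      have hc := f.eq_some_iff.1 c.2.choose_spec
      have h' : b.2.choose = c.2.choose := congrArg Subtype.val h
      rw [h'] at hb
      exact Subtype.ext (Option.some_injective _ (hb.symm.trans hc))

theorem mk_dom_symm (f : M ≃. N) : #(dom f.symm) = #(dom f) :=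
  (mk_dom_symm_le f).antisymm (mk_dom_symm_le f.symm)

theorem mk_dom_trans_le (f : M ≃. N) (g : N ≃. P) : #(dom (f.trans g)) ≤ #(dom f) :=
  Cardinal.mk_le_mk_of_subset fun _ ⟨_, h⟩ =>
    let ⟨b, hb, _⟩ := (PEquiv.trans_eq_some _ _ _ _).1 h
    ⟨b, hb⟩

theorem mk_dom_trans_le_right (f : M ≃. N) (g : N ≃. P) : #(dom (f.trans g)) ≤ #(dom g) := by
  rw [← mk_dom_symm, ← mk_dom_symm g, PEquiv.symm_trans_rev]
  exact mk_dom_trans_le _ _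

theorem IsTotal.trans {f : M ≃. N} {g : N ≃. P} (hf : IsTotal f) (hg : IsTotal g) :
    IsTotal (f.trans g) := fun a =>
  let ⟨b, hb⟩ := hf a
  let ⟨c, hc⟩ := hg b
  ⟨c, (PEquiv.trans_eq_some _ _ _ _).2 ⟨b, hb, hc⟩⟩

/-- The function underlying a total map. -/
noncomputable def IsTotal.fn {f : M ≃. N} (hf : IsTotal f) (a : M) : N := (hf a).choose

theorem IsTotal.apply {f : M ≃. N} (hf : IsTotal f) (a : M) : f a = some (hf.fn a) :=
  (hf a).choose_spec

theorem IsTotal.fn_injective {f : M ≃. N} (hf : IsTotal f) : Function.Injective hf.fn :=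
  fun a b h => f.inj (hf.apply a) (h ▸ hf.apply b)

end Basic

/-! ### Elementary maps and partial embeddings -/

section Elementary

variable {L : FirstOrder.Language.{v, w}} {M N P : Type u}
  [L.Structure M] [L.Structure N] [L.Structure P]

@[simp] theorem ofEmbedding_apply (e : M ↪[L] N) (a : M) : ofEmbedding e a = some (e a) := rfl

theorem isTotal_ofEmbedding (e : M ↪[L] N) : IsTotal (ofEmbedding e) := fun a => ⟨e a, rfl⟩

/-- A formula has finitely many free variables, so infinite families of variables reduce to finite
tuples. -/
theorem IsElementaryMap.realize_iff {f : M ≃. N} (hf : IsElementaryMap L f) {α : Type*}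
    (φ : L.Formula α) {a : α → M} {b : α → N} (h : ∀ i, f (a i) = some (b i)) :
    φ.Realize a ↔ φ.Realize b := by
  classical
  let e := Fintype.equivFin φ.freeVarFinset
  have key := hf _ (φ.restrictFreeVar e) (fun i => a (e.symm i)) (fun i => b (e.symm i))
    (fun i => h _)
  unfold Formula.Realize at key ⊢
  rwa [BoundedFormula.realize_restrictFreeVar a (by simp),
    BoundedFormula.realize_restrictFreeVar b (by simp)] at key

theorem IsElementaryMap.mono {f g : M ≃. N} (hg : IsElementaryMap L g) (h : f ≤ g) :
    IsElementaryMap L f := fun n φ a b hab => hg n φ a b fun i => le_iff.1 h _ _ (hab i)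

theorem IsElementaryMap.symm {f : M ≃. N} (hf : IsElementaryMap L f) :
    IsElementaryMap L f.symm := fun n φ a b hab =>
  (hf n φ b a fun i => f.eq_some_iff.1 (hab i)).symm

theorem IsElementaryMap.trans {f : M ≃. N} {g : N ≃. P} (hf : IsElementaryMap L f)
    (hg : IsElementaryMap L g) : IsElementaryMap L (f.trans g) := fun n φ a c h => by
  choose b hb hc using fun i => (PEquiv.trans_eq_some _ _ _ _).1 (h i)
  exact (hf n φ a b hb).trans (hg n φ b c hc)

theorem isElementaryMap_of_elementaryEmbedding (e : M ↪ₑ[L] N) {f : M ≃. N}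
    (h : ∀ a b, f a = some b → e a = b) : IsElementaryMap L f := fun n φ a b hab => by
  rw [← e.map_formula φ a, show e ∘ a = b from funext fun i => h _ _ (hab i)]

theorem isElementaryMap_ofEmbedding (e : M ↪ₑ[L] N) :
    IsElementaryMap L (ofEmbedding e.toEmbedding) :=
  isElementaryMap_of_elementaryEmbedding e fun _ _ h => Option.some_injective _ h

theorem isElementaryMap_of_equiv (e : M ≃[L] N) : IsElementaryMap L (ofEmbedding e.toEmbedding) :=
  isElementaryMap_of_elementaryEmbedding e.toElementaryEmbedding
    fun _ _ h => Option.some_injective _ h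

theorem IsElementaryMap.elementarilyEquivalent {f : M ≃. N} (hf : IsElementaryMap L f) :
    M ≅[L] N := elementarilyEquivalent_iff.2 fun φ => by
  have := hf.realize_iff (φ : L.Formula Empty) (a := default) (b := default) (fun i => i.elim)
  exact this

/-- Only the empty tuple is to be checked, that is, sentences. This is the starting point for
extensions between elementarily equivalent structures. -/
theorem isElementaryMap_bot (h : M ≅[L] N) : IsElementaryMap L (⊥ : M ≃. N) := by
  intro n φ a b hab
  cases n with
  | succ n => exact absurd (hab 0) (by simp)
  | zero =>
    have := elementarilyEquivalent_iff.1 h (φ.relabel (Fin.elim0 : Fin 0 → Empty))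
    unfold Sentence.Realize at this
    rw [Formula.realize_relabel, Formula.realize_relabel] at this
    convert this using 2

/-- A total elementary map is an elementary embedding. -/
noncomputable def IsElementaryMap.toElementaryEmbedding {f : M ≃. N} (hf : IsElementaryMap L f)
    (ht : IsTotal f) : M ↪ₑ[L] N where
  toFun := ht.fn
  map_formula' n φ a := (hf n φ a (ht.fn ∘ a) fun _ => ht.apply _).symm

/-- A formula satisfied in `M`, with parameters in the domain of an elementary map, is satisfiable
in `N` with the images of the parameters. -/
theorem IsElementaryMap.exists_realize [Nonempty N] {f : M ≃. N} (hf : IsElementaryMap L f)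
    {α β : Type*} (φ : L.Formula (α ⊕ β)) {a : α → M} {b : α → N}
    (h : ∀ i, f (a i) = some (b i)) {x : β → M} (hx : φ.Realize (Sum.elim a x)) :
    ∃ y : β → N, φ.Realize (Sum.elim b y) := by
  classical
  -- Only the finitely many variables of `β` that occur can be quantified. The others receive an
  -- arbitrary value at the end.
  let X : Set β := {i | Sum.inr i ∈ φ.freeVarFinset}
  have : Finite X := by
    refine Set.Finite.preimage (f := Sum.inr) (s := (φ.freeVarFinset : Set (α ⊕ β)))
      (fun _ _ _ _ h => Sum.inr_injective h) (Finset.finite_toSet _)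
  let F : φ.freeVarFinset → α ⊕ X := fun i =>
    match i with
    | ⟨Sum.inl i, _⟩ => Sum.inl i
    | ⟨Sum.inr i, hi⟩ => Sum.inr ⟨i, hi⟩
  let ψ : L.Formula (α ⊕ X) := φ.restrictFreeVar F
  have h1 : ψ.Realize (Sum.elim a fun i => x i) :=
    (BoundedFormula.realize_restrictFreeVar (Sum.elim a x)
      (by rintro ⟨i | i, hi⟩ <;> rfl)).2 hx
  have h2 : (ψ.iExs X).Realize a := Formula.realize_iExs.2 ⟨_, h1⟩
  obtain ⟨y, hy⟩ := Formula.realize_iExs.1 ((hf.realize_iff _ h).1 h2)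
  refine ⟨fun i => if hi : i ∈ X then y ⟨i, hi⟩ else Classical.arbitrary N, ?_⟩
  refine (BoundedFormula.realize_restrictFreeVar (f := F) _ ?_).1 hy
  rintro ⟨i | i, hi⟩
  · rfl
  · have hi' : i ∈ X := hi
    simp [F, hi']

theorem IsPartialEmbedding.realize_iff {f : M ≃. N} (hf : IsPartialEmbedding L f) {α : Type*}
    [Finite α] (φ : L.Formula α) (hφ : BoundedFormula.IsQF φ) {a : α → M} {b : α → N}
    (h : ∀ i, f (a i) = some (b i)) : φ.Realize a ↔ φ.Realize b := by
  obtain ⟨n, ⟨e⟩⟩ := Finite.exists_equiv_fin α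
  have := hf n (φ.relabel e) (hφ.relabel _) (a ∘ e.symm) (b ∘ e.symm) (fun i => h _)
  simpa [Formula.realize_relabel, Function.comp_assoc] using this

/-- The graph of each function symbol is defined by an atomic formula, so preservation of atomic
formulas gives a homomorphism that reflects relations. -/
theorem IsPartialEmbedding.exists_embedding {f : M ≃. N} (hf : IsPartialEmbedding L f)
    (ht : IsTotal f) : ∃ e : M ↪[L] N, f = ofEmbedding e := by
  refine ⟨⟨⟨ht.fn, ht.fn_injective⟩, fun {n} F x => ?_, fun {n} R x => ?_⟩, PEquiv.ext ht.apply⟩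
  · let φ : L.Formula (Fin n ⊕ Unit) :=
      (Term.func F fun i => Term.var (Sum.inl i)).equal (Term.var (Sum.inr ()))
    have := hf.realize_iff φ (BoundedFormula.IsAtomic.isQF (BoundedFormula.IsAtomic.equal _ _))
      (a := Sum.elim x fun _ => Structure.funMap F x)
      (b := Sum.elim (ht.fn ∘ x) fun _ => ht.fn (Structure.funMap F x))
      (by rintro (i | i) <;> exact ht.apply _)
    simp only [φ, Formula.realize_equal, Term.realize, Sum.elim_inl, Sum.elim_inr, true_iff] at this
    exact this.symm
  · let φ : L.Formula (Fin n) := R.formula fun i => Term.var i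
    have := hf.realize_iff φ (BoundedFormula.IsAtomic.isQF (BoundedFormula.IsAtomic.rel _ _))
      (a := x) (b := ht.fn ∘ x) (fun i => ht.apply _)
    simp only [φ, Formula.realize_rel, Term.realize] at this
    exact this.symm

end Elementary

/-! ### Elementary maps from graphs, chains and transfinite extension -/

section Graph

variable {L : FirstOrder.Language.{v, w}} {M N : Type u} [L.Structure M] [L.Structure N]

/-- A relation that preserves all formulas, in one direction, is the graph of an elementary map. -/
theorem exists_isElementaryMap_of_graph (G : M → N → Prop)
    (hG : ∀ (n : ℕ) (φ : L.Formula (Fin n)) (a : Fin n → M) (b : Fin n → N),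
      (∀ i, G (a i) (b i)) → φ.Realize a → φ.Realize b) :
    ∃ g : M ≃. N, IsElementaryMap L g ∧ ∀ a b, g a = some b ↔ G a b := by
  have hG' : ∀ (n : ℕ) (φ : L.Formula (Fin n)) (a : Fin n → M) (b : Fin n → N),
      (∀ i, G (a i) (b i)) → (φ.Realize a ↔ φ.Realize b) := fun n φ a b h =>
    ⟨hG n φ a b h, fun hb => by
      by_contra ha
      exact hG n φ.not a b h (Formula.realize_not.2 ha) hb⟩
  -- Preservation of the formula `x = y` makes the relation functional and injective.
  have key : ∀ a b c d, G a c → G b d → (a = b ↔ c = d) := fun a b c d h h' => by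
    have := hG' 2 ((Term.var 0).equal (Term.var 1)) ![a, b] ![c, d]
      (by intro i; fin_cases i <;> assumption)
    simpa [Formula.realize_equal] using this
  refine ⟨ofGraph G (fun a b c h h' => (key _ _ _ _ h h').1 rfl)
    (fun a b c h h' => (key _ _ _ _ h h').2 rfl), ?_, fun a b => ofGraph_eq_some⟩
  exact fun n φ a b h => hG' n φ a b fun i => ofGraph_eq_some.1 (h i)

/-- The union of a nonempty chain of elementary maps is elementary. -/
theorem exists_isElementaryMap_of_chain (c : Set (M ≃. N)) (hc : IsChain (· ≤ ·) c)
    (hne : c.Nonempty) (h : ∀ g ∈ c, IsElementaryMap L g) :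
    ∃ g : M ≃. N, IsElementaryMap L g ∧ ∀ a b, g a = some b ↔ ∃ k ∈ c, k a = some b := by
  refine exists_isElementaryMap_of_graph _ fun n φ a b hab => ?_
  choose k hk hkab using hab
  have : Nonempty c := hne.to_subtype
  obtain ⟨m, hm⟩ := (directedOn_iff_directed.1 hc.directedOn).finite_le
    (fun i => (⟨k i, hk i⟩ : c))
  exact (h m m.2 n φ a b fun i => le_iff.1 (hm i) _ _ (hkab i)).1

/-- If elementary maps with domain of cardinality less than `μ` can be extended to any further
point, they can be extended to any set of cardinality at most `μ`. -/
theorem IsElementaryMap.exists_extension {μ : Cardinal.{u}} (hμ : ℵ₀ ≤ μ)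
    (hext : ∀ g : M ≃. N, IsElementaryMap L g → #(dom g) < μ →
      ∀ a, ∃ k, g ≤ k ∧ IsElementaryMap L k ∧ a ∈ dom k)
    {f : M ≃. N} (hf : IsElementaryMap L f) (hd : #(dom f) < μ) (S : Set M) (hS : #S ≤ μ) :
    ∃ g, f ≤ g ∧ IsElementaryMap L g ∧ S ⊆ dom g := by
  obtain ⟨e⟩ : Nonempty ((#S).ord.ToType ≃ S) := Cardinal.eq.1 (mk_ord_toType _)
  -- `S` is enumerated in its initial ordinal, and only domains consisting of `dom f` and an initial
  -- segment are admitted. A maximal map that misses a point of `S` then has domain smaller than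
  -- `μ`, so `hext` applies to it.
  let 𝒢 : Set (M ≃. N) := {g | f ≤ g ∧ IsElementaryMap L g ∧
    ∃ I : Set (#S).ord.ToType, IsLowerSet I ∧ dom g = dom f ∪ (fun i => (e i : M)) '' I}
  have hchain : ∀ c ⊆ 𝒢, IsChain (· ≤ ·) c → ∀ y ∈ c, ∃ ub ∈ 𝒢, ∀ z ∈ c, z ≤ ub := by
    intro c hc hch y hy
    obtain ⟨g, hg, hgc⟩ := exists_isElementaryMap_of_chain c hch ⟨y, hy⟩ fun g hg => (hc hg).2.1
    have hle : ∀ z ∈ c, z ≤ g := fun z hz => le_iff.2 fun a b hab => (hgc a b).2 ⟨z, hz, hab⟩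
    refine ⟨g, ⟨(hc hy).1.trans (hle y hy), hg,
      {i | ∃ k ∈ c, ∃ I : Set (#S).ord.ToType, IsLowerSet I ∧
        dom k = dom f ∪ (fun i => (e i : M)) '' I ∧ i ∈ I}, ?_, ?_⟩, hle⟩
    · rintro i j hij ⟨k, hk, I, hI, hkI, hi⟩
      exact ⟨k, hk, I, hI, hkI, hI hij hi⟩
    · ext a
      constructor
      · rintro ⟨b, hb⟩
        obtain ⟨k, hk, hkab⟩ := (hgc _ _).1 hb
        obtain ⟨-, -, I, hI, hkI⟩ := hc hk
        have ha : a ∈ dom k := ⟨b, hkab⟩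
        rw [hkI] at ha
        exact ha.imp id fun ⟨i, hi, hia⟩ => ⟨i, ⟨k, hk, I, hI, hkI, hi⟩, hia⟩
      · rintro (⟨b, hb⟩ | ⟨i, ⟨k, hk, I, hI, hkI, hi⟩, rfl⟩)
        · exact ⟨b, le_iff.1 ((hc hy).1.trans (hle y hy)) _ _ hb⟩
        · have : (e i : M) ∈ dom k := by rw [hkI]; exact Or.inr ⟨i, hi, rfl⟩
          obtain ⟨b, hb⟩ := this
          exact ⟨b, le_iff.1 (hle k hk) _ _ hb⟩
  obtain ⟨g, hfg, hmax⟩ := zorn_le_nonempty₀ 𝒢 hchain f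
    ⟨le_rfl, hf, ∅, isLowerSet_empty, by simp⟩
  obtain ⟨-, hg, I, hI, hgI⟩ := hmax.prop
  refine ⟨g, hfg, hg, ?_⟩
  by_contra hSg
  obtain ⟨s, hs, hsg⟩ := Set.not_subset.1 hSg
  obtain ⟨i, hi, hmin⟩ := WellFounded.has_min (wellFounded_lt (α := (#S).ord.ToType))
    {i | (e i : M) ∉ dom g} ⟨e.symm ⟨s, hs⟩, by simpa using hsg⟩
  have hIi : I ⊆ Set.Iio i := fun j hj => by
    by_contra hji
    refine hi ?_
    rw [hgI]
    exact Or.inr ⟨i, hI (not_lt.1 hji) hj, rfl⟩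
  have hcard : #(dom g) < μ := by
    rw [hgI]
    refine (mk_union_le _ _).trans_lt (add_lt_of_lt hμ hd ?_)
    refine (mk_image_le.trans (mk_le_mk_of_subset hIi)).trans_lt ?_
    exact (mk_Iio_lt i (by simp)).trans_le (by simpa using hS)
  obtain ⟨k, hgk, hk, hik⟩ := hext g hg hcard (e i)
  -- The extension may be defined at superfluous points. They are removed to keep the domain of the
  -- prescribed form.
  let k' := restrict k (dom g ∪ {(e i : M)})
  have hgk' : g ≤ k' := le_iff.2 fun a b hab =>
    restrict_eq_some.2 ⟨Or.inl ⟨b, hab⟩, le_iff.1 hgk _ _ hab⟩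
  have hdom : dom k' = dom g ∪ {(e i : M)} := by
    refine (dom_restrict_subset _ _).antisymm ?_
    rintro a (⟨b, hb⟩ | rfl)
    · exact ⟨b, le_iff.1 hgk' _ _ hb⟩
    · obtain ⟨b, hb⟩ := hik
      exact ⟨b, restrict_eq_some.2 ⟨Or.inr rfl, hb⟩⟩
  have hk' : k' ∈ 𝒢 := by
    refine ⟨hfg.trans hgk', hk.mono (restrict_le _ _), Set.Iic i, isLowerSet_Iic i, ?_⟩
    rw [hdom, hgI]
    ext a
    constructor
    · rintro ((ha | ⟨j, hj, rfl⟩) | rfl)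
      · exact Or.inl ha
      · exact Or.inr ⟨j, Set.mem_Iic.2 (Set.mem_Iio.1 (hIi hj)).le, rfl⟩
      · exact Or.inr ⟨i, Set.self_mem_Iic, rfl⟩
    · rintro (ha | ⟨j, hj, rfl⟩)
      · exact Or.inl (Or.inl ha)
      · rcases (Set.mem_Iic.1 hj).lt_or_eq with hj | rfl
        · have : (e j : M) ∈ dom g := by
            by_contra h
            exact hmin j h hj
          rw [hgI] at this
          exact Or.inl this
        · exact Or.inr rfl
  have : (e i : M) ∈ dom g := by
    obtain ⟨b, hb⟩ : (e i : M) ∈ dom k' := by rw [hdom]; exact Or.inr rfl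
    exact ⟨b, le_iff.1 (hmax.le_of_ge hk' hgk') _ _ hb⟩
  exact hi this

end Graph

/-! ### Extending elementary maps into saturated structures -/

section Saturated

variable {L : FirstOrder.Language.{v, w}} {M N : Type u} [L.Structure M] [L.Structure N]

theorem _root_.IsSaturatedAt.mono {κ μ : Cardinal.{u}} (h : IsSaturatedAt L μ M) (hκ : κ ≤ μ) :
    IsSaturatedAt L κ M := fun A hA => h A (hA.trans_le hκ)

theorem realize_constantsVarsEquiv_formula {A : Set M} {n : ℕ} (φ : L[[A]].Formula (Fin n))
    (x : Fin n → M) :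
    Formula.Realize (L := L) (BoundedFormula.constantsVarsEquiv φ) (Sum.elim (fun a : A => (a : M)) x) ↔
      φ.Realize x := by
  have := BoundedFormula.realize_constantsVarsEquiv (L := L) (α := A) (φ := φ) (v := x)
    (xs := (default : Fin 0 → M))
  simpa [Formula.Realize] using this

/-- The type of `a` over `dom g`, transported along `g`, is finitely satisfiable in `N` because `g`
is elementary. A realization is a possible image of `a`. -/
theorem _root_.IsSaturatedAt.exists_extension [Nonempty N] {κ : Cardinal.{u}}
    (hN : IsSaturatedAt L κ N) {g : M ≃. N} (hg : IsElementaryMap L g) (hd : #(dom g) < κ) (a : M) :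
    ∃ k, g ≤ k ∧ IsElementaryMap L k ∧ a ∈ dom k := by
  choose r hr using fun b : dom g.symm => b.2
  replace hr : ∀ b, g (r b) = some (b : N) := fun b => g.eq_some_iff.1 (hr b)
  let p : Set (L[[dom g.symm]].Formula (Fin 1)) := {ψ |
    Formula.Realize (L := L) (BoundedFormula.constantsVarsEquiv ψ) (Sum.elim r fun _ => a)}
  obtain ⟨x, hx⟩ := hN (dom g.symm) (by rwa [mk_dom_symm]) 1 p (by
    intro q hq hfin
    have : Finite q := hfin
    let φ : L.Formula (dom g.symm ⊕ Fin 1) :=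
      Formula.iInf fun ψ : q => BoundedFormula.constantsVarsEquiv ψ.1
    obtain ⟨y, hy⟩ := hg.exists_realize φ hr (x := fun _ => a)
      (Formula.realize_iInf.2 fun ψ => hq ψ.2)
    exact ⟨y, fun ψ hψ => (realize_constantsVarsEquiv_formula ψ y).1
      (Formula.realize_iInf.1 hy ⟨ψ, hψ⟩)⟩)
  -- The case `a ∈ dom g` needs no separate treatment: consistency with `g` follows from
  -- preservation of equality.
  obtain ⟨k, hk, hkG⟩ := exists_isElementaryMap_of_graph (L := L)
    (fun c d => g c = some d ∨ c = a ∧ d = x 0) (by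
      intro n φ c d hcd hc
      classical
      let σ : Fin n → dom g.symm ⊕ Fin 1 := fun i =>
        if h : g (c i) = some (d i) then Sum.inl ⟨d i, c i, g.eq_some_iff.2 h⟩ else Sum.inr 0
      have h1 : (Sum.elim r fun _ => a) ∘ σ = c := by
        funext i
        by_cases h : g (c i) = some (d i)
        · simp only [σ, h, Function.comp_apply, dite_true, Sum.elim_inl]
          exact g.inj (hr _) h
        · simp only [σ, h, Function.comp_apply, dite_false, Sum.elim_inr]
          exact ((hcd i).resolve_left h).1.symm
      have h2 : (Sum.elim (fun b : dom g.symm => (b : N)) x) ∘ σ = d := by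
        funext i
        by_cases h : g (c i) = some (d i)
        · simp only [σ, h, Function.comp_apply, dite_true, Sum.elim_inl]
        · simp only [σ, h, Function.comp_apply, dite_false, Sum.elim_inr]
          exact ((hcd i).resolve_left h).2.symm
      have h3 := hx (BoundedFormula.constantsVarsEquiv.symm (φ.relabel σ)) (by
        change Formula.Realize _ _
        rw [Equiv.apply_symm_apply, Formula.realize_relabel, h1]
        exact hc)
      rw [← realize_constantsVarsEquiv_formula, Equiv.apply_symm_apply, Formula.realize_relabel,
        h2] at h3
      exact h3)
  exact ⟨k, le_iff.2 fun c d h => (hkG c d).2 (Or.inl h), hk, x 0, (hkG _ _).2 (Or.inr ⟨rfl, rfl⟩)⟩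

end Saturated

end PartialMap

/-! ### Löwenheim–Skolem and compactness -/

namespace FirstOrder.Language

variable {L : FirstOrder.Language.{v, w}} [Countable L.Symbols]

theorem lift_card_le_lift {κ : Cardinal.{u}} (hκ : ℵ₀ ≤ κ) :
    Cardinal.lift.{u} L.card ≤ Cardinal.lift.{max v w} κ := by
  have h : L.card ≤ ℵ₀ := Cardinal.mk_le_aleph0_iff.2 inferInstance
  exact (Cardinal.lift_le_aleph0.2 h).trans (Cardinal.aleph0_le_lift.2 hκ)

/-- Downward Löwenheim–Skolem for countable languages. -/
theorem exists_elementarySubstructure {M : Type u} [L.Structure M] (s : Set M) {κ : Cardinal.{u}}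
    (h0 : ℵ₀ ≤ κ) (hs : #s ≤ κ) (hM : κ ≤ #M) :
    ∃ S : L.ElementarySubstructure M, s ⊆ S ∧ #S = κ := by
  obtain ⟨S, h1, h2⟩ := exists_elementarySubstructure_card_eq L s κ h0 (by simpa using hs)
    (lift_card_le_lift h0) (by simpa using hM)
  exact ⟨S, h1, by simpa using h2⟩

/-- Upward Löwenheim–Skolem for countable languages. -/
theorem exists_elementaryEmbedding_mk_eq (M : Type u) [L.Structure M] [Infinite M]
    {κ : Cardinal.{u}} (hM : #M ≤ κ) :
    ∃ (N : Type u) (_ : L.Structure N), Nonempty (M ↪ₑ[L] N) ∧ #N = κ := by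
  obtain ⟨N, h1, h2⟩ := exists_elementaryEmbedding_card_eq_of_ge L M κ
    (lift_card_le_lift ((aleph0_le_mk M).trans hM)) (by simpa using hM)
  exact ⟨N, N.str, h1, h2⟩

/-- Łoś's theorem in an ultrapower over the finite subsets of `Γ`. The bound on `X` allows the
ultrapower to be cut down to the size of `N`, around the images of `N` and `X`. -/
theorem exists_elementaryEmbedding_realize_aux {N : Type u} [L.Structure N] [Infinite N]
    {D : Type*} {X : Type u} (hX : #X ≤ #N) (b : D → N) (Γ : Set (L.Formula (D ⊕ X)))
    (hΓ : ∀ q ⊆ Γ, q.Finite → ∃ y : X → N, ∀ φ ∈ q, φ.Realize (Sum.elim b y)) :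
    ∃ (N' : Type u) (_ : L.Structure N') (j : N ↪ₑ[L] N') (y : X → N'),
      ∀ φ ∈ Γ, φ.Realize (Sum.elim (j ∘ b) y) := by
  have hΓ' : ∀ q : Finset Γ, ∃ y : X → N, ∀ φ ∈ q, φ.1.Realize (Sum.elim b y) := fun q => by
    obtain ⟨y, hy⟩ := hΓ (Subtype.val '' (q : Set Γ)) (by simp) (q.finite_toSet.image _)
    exact ⟨y, fun φ hφ => hy _ ⟨φ, hφ, rfl⟩⟩
  choose y hy using hΓ'
  -- An ultrafilter finer than `atTop` contains, for each formula of `Γ`, the set of the finite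
  -- subsets to which it belongs.
  let U : Ultrafilter (Finset Γ) := Ultrafilter.of Filter.atTop
  let P := (U : Filter (Finset Γ)).Product fun _ => N
  let j : N ↪ₑ[L] P :=
    { toFun := fun a => ((fun _ => a : Finset Γ → N) : P)
      map_formula' := fun n φ x => by
        have := Ultraproduct.realize_formula_cast (u := U) (M := fun _ => N) φ (fun i _ => x i)
        rw [Filter.eventually_const] at this
        exact this }
  let z : X → P := fun x => ((fun q => y q x : Finset Γ → N) : P)
  have hz : ∀ φ ∈ Γ, φ.Realize (Sum.elim (j ∘ b) z) := by
    intro φ hφ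
    have := Ultraproduct.realize_formula_cast (u := U) (M := fun _ => N) φ
      (Sum.elim (fun d _ => b d) fun x q => y q x)
    have h2 : (Sum.elim (j ∘ b) z) = fun i => ((Sum.elim (fun d _ => b d) (fun x q => y q x) i :
        Finset Γ → N) : P) := by
      funext i
      cases i <;> rfl
    rw [h2]
    refine this.2 ?_
    have h3 : ∀ᶠ q in (U : Filter (Finset Γ)), ({⟨φ, hφ⟩} : Finset Γ) ≤ q :=
      Ultrafilter.of_le _ (Filter.eventually_ge_atTop _)
    filter_upwards [h3] with q hq
    have h4 := hy q ⟨φ, hφ⟩ (hq (by simp))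
    convert h4 using 1
    funext i
    cases i <;> rfl
  obtain ⟨S, hS, hcard⟩ := exists_elementarySubstructure_card_eq L
    (Set.range j ∪ Set.range z) #N (aleph0_le_mk N) (by
      refine (lift_le.2 (mk_union_le _ _)).trans ?_
      rw [lift_add]
      refine (add_le_add (mk_range_le_lift (f := j)) (mk_range_le_lift (f := z))).trans ?_
      rw [← lift_add, lift_le]
      exact add_le_of_le (aleph0_le_mk N) le_rfl hX) (lift_card_le_lift (aleph0_le_mk N))
      (mk_le_of_injective (f := fun a => ULift.up (j a.down))
        fun a c h => ULift.ext _ _ (j.injective (by simpa using h)))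
  -- The ultrapower may live in a larger universe, but `S` has the cardinality of `N` and can be
  -- moved back.
  have : Small.{u} S := by
    rw [← lift_inj.{_, u + 1}, lift_lift, lift_lift] at hcard
    exact small_iff_lift_mk_lt_univ.2 (lt_of_eq_of_lt hcard (#N).lift_lt_univ')
  let e : Shrink.{u} S ≃ S := (equivShrink S).symm
  let _ : L.Structure (Shrink.{u} S) := e.symm.inducedStructure
  let e' : S ≃[L] Shrink.{u} S := e.symm.inducedStructureEquiv
  have hj : ∀ a, j a ∈ S := fun a => hS (Or.inl ⟨a, rfl⟩)
  have hz' : ∀ x, z x ∈ S := fun x => hS (Or.inr ⟨x, rfl⟩)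
  refine ⟨Shrink.{u} S, inferInstance, ⟨fun a => e' ⟨j a, hj a⟩, fun n φ x => ?_⟩,
    fun x => e' ⟨z x, hz' x⟩, fun φ hφ => ?_⟩
  · exact (e'.toElementaryEmbedding.map_formula φ fun i => ⟨j (x i), hj _⟩).trans
      ((S.subtype.map_formula φ fun i => ⟨j (x i), hj _⟩).symm.trans (j.map_formula φ x))
  · let t : D ⊕ X → S := Sum.elim (fun d => ⟨j (b d), hj _⟩) fun x => ⟨z x, hz' x⟩
    have h1 : S.subtype ∘ t = Sum.elim (j ∘ b) z := by funext i; cases i <;> rfl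
    have h2 := (S.subtype.map_formula φ t).1 (by rw [h1]; exact hz φ hφ)
    convert (e'.toElementaryEmbedding.map_formula φ t).2 h2 using 1
    funext i
    cases i <;> rfl

/-- A finitely satisfiable set of formulas, in arbitrarily many variables and with parameters, is
realized in an elementary extension. -/
theorem exists_elementaryEmbedding_realize {N : Type u} [L.Structure N] [Infinite N]
    {D : Type*} {X : Type u} (b : D → N) (Γ : Set (L.Formula (D ⊕ X)))
    (hΓ : ∀ q ⊆ Γ, q.Finite → ∃ y : X → N, ∀ φ ∈ q, φ.Realize (Sum.elim b y)) :
    ∃ (N' : Type u) (_ : L.Structure N') (j : N ↪ₑ[L] N') (y : X → N'),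
      ∀ φ ∈ Γ, φ.Realize (Sum.elim (j ∘ b) y) := by
  obtain ⟨N₁, _, ⟨j₁⟩, hN₁⟩ := exists_elementaryEmbedding_mk_eq (L := L) N
    (le_max_left #N #X)
  have : Infinite N₁ := Infinite.of_injective _ j₁.injective
  obtain ⟨N', _, j, y, hy⟩ := exists_elementaryEmbedding_realize_aux (N := N₁)
    ((le_max_right _ _).trans hN₁.ge) (j₁ ∘ b) Γ (fun q hq hfin => by
      obtain ⟨y, hy⟩ := hΓ q hq hfin
      refine ⟨j₁ ∘ y, fun φ hφ => ?_⟩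
      rw [← Sum.comp_elim]
      exact (j₁.map_formula φ _).2 (hy φ hφ))
  exact ⟨N', inferInstance, j.comp j₁, y, hy⟩

end FirstOrder.Language

open PartialMap

/-! ### Finite extensions, back and forth, and saturation of rich models -/

namespace InductiveAmalgamationClass

variable {L : FirstOrder.Language.{v, w}} (K : InductiveAmalgamationClass.{u, v, w} L)
  {M N U V : Type u} [L.Structure M] [L.Structure N] [L.Structure U] [L.Structure V]

section Basic

variable {K}

theorem obj_of_elementaryEmbedding (hM : K.Obj M) (e : M ↪ₑ[L] N) : K.Obj N :=
  K.K0 hM e.elementarilyEquivalent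

theorem obj_of_elementarySubstructure (hM : K.Obj M) (S : L.ElementarySubstructure M) : K.Obj S :=
  K.K0 hM S.elementarilyEquivalent.symm

theorem mor_of_elementaryEmbedding (hM : K.Obj M) (e : M ↪ₑ[L] N) :
    K.Mor (ofEmbedding e.toEmbedding) :=
  K.K1 hM (obj_of_elementaryEmbedding hM e) (isElementaryMap_ofEmbedding e)

theorem mor_of_equiv (hM : K.Obj M) (e : M ≃[L] N) : K.Mor (ofEmbedding e.toEmbedding) :=
  mor_of_elementaryEmbedding hM e.toElementaryEmbedding

theorem mor_subtype (hM : K.Obj M) (S : L.ElementarySubstructure M) :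
    K.Mor (ofEmbedding S.subtype.toEmbedding) :=
  mor_of_elementaryEmbedding (obj_of_elementarySubstructure hM S) S.subtype

theorem IsStrongEmbedding.trans {f : M ≃. N} {g : N ≃. U} (hf : K.IsStrongEmbedding f)
    (hg : K.IsStrongEmbedding g) : K.IsStrongEmbedding (f.trans g) :=
  ⟨K.comp hf.1 hg.1, hf.2.trans hg.2⟩

theorem isStrongEmbedding_of_elementaryEmbedding (hM : K.Obj M) (e : M ↪ₑ[L] N) :
    K.IsStrongEmbedding (ofEmbedding e.toEmbedding) :=
  ⟨mor_of_elementaryEmbedding hM e, isTotal_ofEmbedding _⟩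

theorem IsStrongEmbedding.exists_embedding {f : M ≃. N} (hf : K.IsStrongEmbedding f) :
    ∃ e : M ↪[L] N, f = ofEmbedding e :=
  (K.isPartialEmbedding_of_mor hf.1).exists_embedding hf.2

/-- A strong embedding of an elementary substructure of `M` that extends `f : M → U` provides
an extension of `f`. -/
theorem exists_le_of_elementarySubstructure (hM : K.Obj M) {f : M ≃. U}
    (S : L.ElementarySubstructure M) (hS : dom f ⊆ S) {h : S ≃. U} (hh : K.IsStrongEmbedding h)
    (hle : (ofEmbedding S.subtype.toEmbedding).trans f ≤ h) :
    ∃ g : M ≃. U, K.Mor g ∧ f ≤ g ∧ (S : Set M) ⊆ dom g := by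
  have key : ∀ a : S, (ofEmbedding S.subtype.toEmbedding).symm (a : M) = some a := fun a =>
    (PEquiv.eq_some_iff _).2 rfl
  refine ⟨(ofEmbedding S.subtype.toEmbedding).symm.trans h,
    K.comp (K.K2 (mor_subtype hM S)) hh.1, le_iff.2 fun a b hab => ?_, fun a ha => ?_⟩
  · have ha : a ∈ S := hS ⟨b, hab⟩
    exact (PEquiv.trans_eq_some _ _ _ _).2 ⟨⟨a, ha⟩, key ⟨a, ha⟩,
      le_iff.1 hle _ _ ((PEquiv.trans_eq_some _ _ _ _).2 ⟨a, rfl, hab⟩)⟩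
  · obtain ⟨b, hb⟩ := hh.2 ⟨a, ha⟩
    exact ⟨b, (PEquiv.trans_eq_some _ _ _ _).2 ⟨⟨a, ha⟩, key ⟨a, ha⟩, hb⟩⟩

end Basic

/-- Morphisms with finite domain extend to any further point. -/
def HasFiniteExtension (M N : Type u) [L.Structure M] [L.Structure N] : Prop :=
  ∀ f : M ≃. N, K.Mor f → (dom f).Finite → ∀ a, ∃ g : M ≃. N, K.Mor g ∧ f ≤ g ∧ a ∈ dom g

variable {K}

/-- Back and forth, by induction on the formula. Only quantifiers need an extension of the morphism,
and one further point suffices for each. -/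
theorem realize_iff_of_hasFiniteExtension (h₁ : K.HasFiniteExtension M N)
    (h₂ : K.HasFiniteExtension N M) {m n : ℕ} (φ : L.BoundedFormula (Fin m) n) :
    ∀ f : M ≃. N, K.Mor f → ∀ (a : Fin m → M) (b : Fin m → N) (x : Fin n → M) (y : Fin n → N),
      (∀ i, f (a i) = some (b i)) → (∀ i, f (x i) = some (y i)) →
      (φ.Realize a x ↔ φ.Realize b y) := by
  have atom : ∀ {k : ℕ} (ψ : L.BoundedFormula (Fin m) k), BoundedFormula.IsQF ψ.toFormula →
      ∀ f : M ≃. N, K.Mor f → ∀ (a : Fin m → M) (b : Fin m → N) (x : Fin k → M) (y : Fin k → N),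
      (∀ i, f (a i) = some (b i)) → (∀ i, f (x i) = some (y i)) →
      (ψ.Realize a x ↔ ψ.Realize b y) := by
    intro k ψ hψ f hf a b x y hab hxy
    have := (K.isPartialEmbedding_of_mor hf).realize_iff ψ.toFormula hψ (a := Sum.elim a x)
      (b := Sum.elim b y) (by rintro (i | i) <;> simp [hab, hxy])
    simpa [BoundedFormula.realize_toFormula] using this
  induction φ with
  | falsum => exact fun _ _ _ _ _ _ _ _ => Iff.rfl
  | equal t₁ t₂ => exact atom _ (BoundedFormula.IsAtomic.isQF (BoundedFormula.IsAtomic.equal _ _))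
  | rel R ts => exact atom _ (BoundedFormula.IsAtomic.isQF (BoundedFormula.IsAtomic.rel _ _))
  | imp φ ψ ih₁ ih₂ =>
    intro f hf a b x y hab hxy
    rw [BoundedFormula.realize_imp, BoundedFormula.realize_imp, ih₁ f hf a b x y hab hxy,
      ih₂ f hf a b x y hab hxy]
  | all φ ih =>
    intro f hf a b x y hab hxy
    rw [BoundedFormula.realize_all, BoundedFormula.realize_all]
    -- The morphism itself may have infinite domain. It is restricted to the finitely many elements
    -- in play before it is extended.
    have hfin : (Set.range a ∪ Set.range x).Finite := (Set.finite_range a).union (Set.finite_range x)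
    let f' := restrict f (Set.range a ∪ Set.range x)
    have hf' : K.Mor f' := K.R hf (restrict_le _ _)
    have hd : (dom f').Finite := hfin.subset (dom_restrict_subset _ _)
    have hab' : ∀ i, f' (a i) = some (b i) := fun i =>
      restrict_eq_some.2 ⟨Or.inl ⟨i, rfl⟩, hab i⟩
    have hxy' : ∀ i, f' (x i) = some (y i) := fun i =>
      restrict_eq_some.2 ⟨Or.inr ⟨i, rfl⟩, hxy i⟩
    have step : ∀ g : M ≃. N, K.Mor g → f' ≤ g → ∀ c d, g c = some d →
        (φ.Realize a (Fin.snoc x c) ↔ φ.Realize b (Fin.snoc y d)) := by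
      intro g hg hle c d hcd
      refine ih g hg a b _ _ (fun i => le_iff.1 hle _ _ (hab' i)) fun i => ?_
      refine Fin.lastCases ?_ (fun i => ?_) i
      · simpa using hcd
      · simpa using le_iff.1 hle _ _ (hxy' i)
    constructor
    · intro h d
      have hd' : (dom f'.symm).Finite := by
        rw [← Set.finite_coe_iff, ← Cardinal.lt_aleph0_iff_finite, mk_dom_symm,
          Cardinal.lt_aleph0_iff_finite]
        exact hd
      obtain ⟨g, hg, hle, c, hc⟩ := h₂ f'.symm (K.K2 hf') hd' d
      refine (step g.symm (K.K2 hg) (le_iff.2 fun p q hpq => ?_) c d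
        (g.eq_some_iff.2 hc)).1 (h c)
      exact g.eq_some_iff.2 (le_iff.1 hle _ _ (f'.eq_some_iff.2 hpq))
    · intro h c
      obtain ⟨g, hg, hle, d, hd⟩ := h₁ f' hf' hd c
      exact (step g hg hle c d hd).2 (h d)

/-- If morphisms with finite domain can be extended back and forth, morphisms are elementary. -/
theorem isElementaryMap_of_hasFiniteExtension (h₁ : K.HasFiniteExtension M N)
    (h₂ : K.HasFiniteExtension N M) {f : M ≃. N} (hf : K.Mor f) : IsElementaryMap L f :=
  fun _ φ a b hab => by
    have := realize_iff_of_hasFiniteExtension h₁ h₂ φ f hf a b default default hab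
      (fun i => i.elim0)
    exact this

theorem IsRichAt.mono {κ μ : Cardinal.{u}} (hU : K.IsRichAt μ U) (h : κ ≤ μ) : K.IsRichAt κ U :=
  ⟨hU.1, fun M _ f hf h1 h2 => hU.2 M f hf h1 (h2.trans h)⟩

variable (K) in
/-- Morphisms from models of cardinality less than `μ` extend to strong embeddings. -/
def IsWeaklyRichAt (μ : Cardinal.{u}) (U : Type u) [L.Structure U] : Prop :=
  K.Obj U ∧ ∀ (M : Type u) [L.Structure M] (f : M ≃. U),
    K.Mor f → #M < μ → ∃ h : M ≃. U, K.IsStrongEmbedding h ∧ f ≤ h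

theorem IsRich.aleph0_le (hU : K.IsRich U) : ℵ₀ ≤ #U :=
  have := K.infinite_of_obj hU.1
  aleph0_le_mk U

variable [Countable L.Symbols]

/-- The source is replaced by a countable elementary substructure that contains the domain and the
new point. Its size is at most `κ` and exceeds that of the finite domain. -/
theorem IsRichAt.hasFiniteExtension {κ : Cardinal.{u}} (hκ : ℵ₀ ≤ κ) (hU : K.IsRichAt κ U) :
    K.HasFiniteExtension M U := by
  intro f hf hfin a
  have hM := (K.obj_of_mor hf).1
  have := K.infinite_of_obj hM
  obtain ⟨S, hS, hcard⟩ := exists_elementarySubstructure (L := L) (insert a (dom f)) le_rfl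
    (Cardinal.lt_aleph0_iff_finite.2 (hfin.insert a)).le (aleph0_le_mk M)
  obtain ⟨h, hh, hle⟩ := hU.2 S ((ofEmbedding S.subtype.toEmbedding).trans f)
    (K.comp (mor_subtype hM S) hf)
    ((mk_dom_trans_le_right _ _).trans_lt (by
      rw [hcard]; exact Cardinal.lt_aleph0_iff_finite.2 hfin)) (hcard.trans_le hκ)
  obtain ⟨g, hg, hle', hd⟩ :=
    exists_le_of_elementarySubstructure hM S ((Set.subset_insert _ _).trans hS) hh hle
  exact ⟨g, hg, hle', hd (hS (Set.mem_insert _ _))⟩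

theorem IsWeaklyRichAt.exists_extension {μ : Cardinal.{u}} (hμ : ℵ₀ < μ)
    (hU : K.IsWeaklyRichAt μ U) {f : M ≃. U} (hf : K.Mor f) (hd : #(dom f) < μ) (a : M) :
    ∃ g : M ≃. U, K.Mor g ∧ f ≤ g ∧ a ∈ dom g := by
  have hM := (K.obj_of_mor hf).1
  have := K.infinite_of_obj hM
  obtain ⟨S, hS, hcard⟩ := exists_elementarySubstructure (L := L) (insert a (dom f))
    (κ := max ℵ₀ #(insert a (dom f) : Set M)) (le_max_left _ _) (le_max_right _ _)
    (max_le (aleph0_le_mk M) (mk_set_le _))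
  obtain ⟨h, hh, hle⟩ := hU.2 S ((ofEmbedding S.subtype.toEmbedding).trans f)
    (K.comp (mor_subtype hM S) hf) (by
      rw [hcard]
      exact max_lt hμ (mk_insert_le.trans_lt
        (add_lt_of_lt hμ.le hd (one_lt_aleph0.trans hμ))))
  obtain ⟨g, hg, hle', hd⟩ :=
    exists_le_of_elementarySubstructure hM S ((Set.subset_insert _ _).trans hS) hh hle
  exact ⟨g, hg, hle', hd (hS (Set.mem_insert _ _))⟩

theorem IsWeaklyRichAt.hasFiniteExtension {μ : Cardinal.{u}} (hμ : ℵ₀ < μ)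
    (hU : K.IsWeaklyRichAt μ U) : K.HasFiniteExtension M U := fun _ hf hfin a =>
  hU.exists_extension hμ hf ((Cardinal.lt_aleph0_iff_finite.2 hfin).trans hμ) a

/-- Morphisms between rich models are elementary. -/
theorem IsRichAt.isElementaryMap {κ μ : Cardinal.{u}} (hκ : ℵ₀ ≤ κ) (hμ : ℵ₀ ≤ μ)
    (hU : K.IsRichAt κ U) (hV : K.IsRichAt μ V) {f : U ≃. V} (hf : K.Mor f) :
    IsElementaryMap L f :=
  isElementaryMap_of_hasFiniteExtension (hV.hasFiniteExtension hμ) (hU.hasFiniteExtension hκ) hf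

/-- If every morphism into the `κ`-rich model `U` from a model elementarily equivalent to `U` is
elementary, then `U` is `κ`-saturated. -/
theorem IsRichAt.isSaturatedAt {κ : Cardinal.{u}} (hκ : ℵ₀ ≤ κ) (hU : K.IsRichAt κ U)
    (hel : ∀ (M : Type u) [L.Structure M], M ≅[L] U → ∀ f : M ≃. U, K.Mor f →
      IsElementaryMap L f) : IsSaturatedAt L κ U := by
  intro A hA n p hp
  have := K.infinite_of_obj hU.1
  obtain ⟨U₁, _, j₁, y, hy⟩ := exists_elementaryEmbedding_realize (L := L) (N := U)
    (X := ULift.{u} (Fin n)) (fun a : A => (a : U))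
    ((fun φ => Formula.relabel (Sum.map id ULift.up) (BoundedFormula.constantsVarsEquiv φ)) '' p)
    (by
      intro q hq hfin
      obtain ⟨q', hq', hfin', rfl⟩ :=
        (Set.exists_subset_image_finite_and (p := (q = ·))).1 ⟨q, hq, hfin, rfl⟩
      obtain ⟨x, hx⟩ := hp q' hq' hfin'
      refine ⟨fun i => x i.down, ?_⟩
      rintro _ ⟨φ, hφ, rfl⟩
      rw [Formula.realize_relabel]
      convert (realize_constantsVarsEquiv_formula φ x).2 (hx φ hφ) using 1
      funext i
      cases i <;> rfl)
  have : Infinite U₁ := Infinite.of_injective _ j₁.injective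
  -- `U` may be smaller than `κ`. The extension makes room for a substructure of size exactly `κ`,
  -- so that `#A < κ` yields the strict inequality required by richness.
  obtain ⟨U₂, _, ⟨j₂⟩, hU₂⟩ := exists_elementaryEmbedding_mk_eq (L := L) U₁ (le_max_left #U₁ κ)
  let j := j₂.comp j₁
  have hobj : K.Obj U₂ := obj_of_elementaryEmbedding hU.1 j
  obtain ⟨S, hS, hcard⟩ := exists_elementarySubstructure (L := L)
    (j '' A ∪ Set.range (j₂ ∘ y)) hκ ((mk_union_le _ _).trans (add_le_of_le hκ
      (mk_image_le.trans hA.le) (mk_range_le.trans (by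
        rw [mk_uLift, mk_fin]; simpa using (natCast_lt_aleph0.le.trans hκ)))))
    ((le_max_right _ _).trans hU₂.ge)
  -- The identity on `A`, with `U` seen inside `U₂` through `j`.
  let f : S ≃. U := restrict ((ofEmbedding S.subtype.toEmbedding).trans
    (ofEmbedding j.toEmbedding).symm) {s | ∃ a ∈ A, j a = s}
  have hf : K.Mor f := K.R (K.comp (mor_subtype hobj S)
    (K.K2 (mor_of_elementaryEmbedding hU.1 j))) (restrict_le _ _)
  have hjS : ∀ a ∈ A, j a ∈ S := fun a ha => hS (Or.inl ⟨a, ha, rfl⟩)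
  have hyS : ∀ i, j₂ (y i) ∈ S := fun i => hS (Or.inr ⟨i, rfl⟩)
  have hfA : ∀ a (ha : a ∈ A), f ⟨j a, hjS a ha⟩ = some a := fun a ha =>
    restrict_eq_some.2 ⟨⟨a, ha, rfl⟩,
      (PEquiv.trans_eq_some _ _ _ _).2 ⟨j a, rfl, (PEquiv.eq_some_iff _).2 rfl⟩⟩
  have hfd : #(dom f) < #S := by
    rw [hcard]
    refine lt_of_le_of_lt ?_ hA
    refine (mk_le_mk_of_subset (dom_restrict_subset _ _)).trans ?_
    refine mk_le_of_surjective (f := fun a : A => (⟨⟨j a, hjS a a.2⟩, a, a.2, rfl⟩ :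
      {s : S | ∃ a ∈ A, j a = s})) ?_
    rintro ⟨⟨s, hs⟩, a, ha, h⟩
    exact ⟨⟨a, ha⟩, Subtype.ext (Subtype.ext h)⟩
  obtain ⟨h, hh, hle⟩ := hU.2 S f hf hfd hcard.le
  have hhe := hel S (S.elementarilyEquivalent.trans j.elementarilyEquivalent.symm) h hh.1
  refine ⟨fun i => hh.2.fn ⟨j₂ (y ⟨i⟩), hyS _⟩, fun φ hφ => ?_⟩
  rw [← realize_constantsVarsEquiv_formula]
  let t : A ⊕ Fin n → S := Sum.elim (fun a => ⟨j a, hjS a a.2⟩) fun i => ⟨j₂ (y ⟨i⟩), hyS _⟩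
  refine (hhe.realize_iff _ (a := t) ?_).1 ?_
  · rintro (a | i)
    · exact le_iff.1 hle _ _ (hfA a a.2)
    · exact hh.2.apply _
  · rw [← S.subtype.map_formula]
    have h1 := hy _ ⟨φ, hφ, rfl⟩
    rw [Formula.realize_relabel, ← j₂.map_formula] at h1
    convert h1 using 1
    funext i
    cases i <;> rfl

end InductiveAmalgamationClass

/-! ### Chains, amalgams of bounded size and models with named elements -/

/-- Construction of a chain by transfinite recursion. -/
theorem exists_monotone_of_wellFoundedLT {W P : Type*} [LinearOrder W] [WellFoundedLT W]
    [Preorder P] [Nonempty P] (Q : W → P → Prop) (R : W → P → P → Prop)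
    (h : ∀ i (c : Set.Iio i → P), Monotone c → (∀ j : Set.Iio i, Q j (c j)) →
      ∃ q, Q i q ∧ ∀ j, c j ≤ q ∧ R i (c j) q) :
    ∃ c : W → P, Monotone c ∧ (∀ i, Q i (c i)) ∧ ∀ j i, j < i → R i (c j) (c i) := by
  classical
  -- The default value is never taken along the recursion, as `good` shows.
  let F : ∀ i, (∀ j, j < i → P) → P := fun i r =>
    if hq : ∃ q, Q i q ∧ ∀ j : Set.Iio i, r j j.2 ≤ q ∧ R i (r j j.2) q then hq.choose
    else Classical.arbitrary P
  let c : W → P := WellFoundedLT.fix F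
  have hc : ∀ i, c i = F i fun j _ => c j := fun i => WellFoundedLT.fix_eq F i
  have good : ∀ i, Q i (c i) ∧ ∀ j : Set.Iio i, c j ≤ c i ∧ R i (c j) (c i) := by
    intro i
    induction i using WellFoundedLT.induction with
    | ind i ih =>
      have hq := h i (fun j => c j) (fun j k hjk => by
        rcases (show (j : W) ≤ k from hjk).lt_or_eq with hlt | heq
        · exact ((ih k k.2).2 ⟨j, hlt⟩).1
        · rw [Subtype.ext heq]) (fun j => (ih j j.2).1)
      have : c i = hq.choose := by
        rw [hc]
        exact dif_pos hq
      rw [this]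
      exact hq.choose_spec
  refine ⟨c, fun j i hji => ?_, fun i => (good i).1, fun j i hji => ((good i).2 ⟨j, hji⟩).2⟩
  rcases hji.lt_or_eq with hlt | rfl
  · exact ((good i).2 ⟨j, hlt⟩).1
  · exact le_rfl

theorem PartialMap.ofEmbedding_comp {L : FirstOrder.Language.{v, w}} {M N P : Type u}
    [L.Structure M] [L.Structure N] [L.Structure P] (e : M ↪[L] N) (e' : N ↪[L] P) :
    ofEmbedding (e'.comp e) = (ofEmbedding e).trans (ofEmbedding e') :=
  PEquiv.ext fun _ => rfl

namespace InductiveAmalgamationClass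

variable {L : FirstOrder.Language.{v, w}} {K : InductiveAmalgamationClass.{u, v, w} L}

/-- A strong embedding into a strong extension of `N`, of cardinality at most `μ`. -/
theorem exists_amalgam [Countable L.Symbols] {M N : Type u} [L.Structure M] [L.Structure N]
    {f : M ≃. N} (hf : K.Mor f) {μ : Cardinal.{u}} (hM : #M ≤ μ) (hN : #N ≤ μ) :
    ∃ (E : Type u) (_ : L.Structure E) (j : N ≃. E) (h : M ≃. E),
      K.IsStrongEmbedding j ∧ K.IsStrongEmbedding h ∧ f.trans j ≤ h ∧ #E ≤ μ := by
  obtain ⟨N', _, j, h, hj, hh, hle⟩ := K.Ap hf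
  have hobj := (K.obj_of_mor hj.1).2
  have := K.infinite_of_obj hobj
  have := K.infinite_of_obj (K.obj_of_mor hf).2
  have hμ : ℵ₀ ≤ μ := (aleph0_le_mk N).trans hN
  -- The amalgam is cut down to an elementary substructure around the images of both models.
  obtain ⟨S, hS, hcard⟩ := exists_elementarySubstructure (L := L)
    (Set.range hj.2.fn ∪ Set.range hh.2.fn)
    (κ := max ℵ₀ #(Set.range hj.2.fn ∪ Set.range hh.2.fn : Set N'))
    (le_max_left _ _) (le_max_right _ _) (max_le (aleph0_le_mk N') (mk_set_le _))
  have key : ∀ a : S, (ofEmbedding S.subtype.toEmbedding).symm (a : N') = some a := fun a =>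
    (PEquiv.eq_some_iff _).2 rfl
  have hmor := K.K2 (mor_subtype hobj S)
  have lift : ∀ {A : Type u} [L.Structure A] {g : A ≃. N'} (hg : K.Mor g ∧ IsTotal g),
      Set.range hg.2.fn ⊆ S →
      K.IsStrongEmbedding (g.trans (ofEmbedding S.subtype.toEmbedding).symm) := by
    intro A _ g hg hr
    refine ⟨K.comp hg.1 hmor, fun a => ⟨⟨hg.2.fn a, hr ⟨a, rfl⟩⟩, ?_⟩⟩
    exact (PEquiv.trans_eq_some _ _ _ _).2 ⟨_, hg.2.apply a, key ⟨hg.2.fn a, hr ⟨a, rfl⟩⟩⟩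
  refine ⟨S, inferInstance, _, _, lift hj (Set.subset_union_left.trans hS),
    lift hh (Set.subset_union_right.trans hS), le_iff.2 fun a b hab => ?_, ?_⟩
  · rw [← PEquiv.trans_assoc] at hab
    obtain ⟨c, hc, hcb⟩ := (PEquiv.trans_eq_some _ _ _ _).1 hab
    exact (PEquiv.trans_eq_some _ _ _ _).2 ⟨c, le_iff.1 hle _ _ hc, hcb⟩
  · rw [hcard]
    exact max_le hμ ((mk_union_le _ _).trans
      (add_le_of_le hμ (mk_range_le.trans hN) (mk_range_le.trans hM)))

variable (K) in
/-- A model whose elements have distinct names in `W`. -/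
structure NamedModel (W : Type u) where
  /-- The underlying type. -/
  carrier : Type u
  [str : L.Structure carrier]
  obj : K.Obj carrier
  /-- The name of an element. -/
  name : carrier → W
  name_injective : Function.Injective name

namespace NamedModel

attribute [instance] NamedModel.str

variable {W : Type u}

/-- `p ≤ q` if there is a strong embedding that preserves names. -/
instance : Preorder (K.NamedModel W) where
  le p q := ∃ e : p.carrier ↪[L] q.carrier, K.Mor (ofEmbedding e) ∧ ∀ x, q.name (e x) = p.name x
  le_refl p := ⟨Embedding.refl L _,
    mor_of_elementaryEmbedding p.obj (ElementaryEmbedding.refl L _), fun _ => rfl⟩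
  le_trans p q r := fun ⟨e, he, hn⟩ ⟨e', he', hn'⟩ =>
    ⟨e'.comp e, ofEmbedding_comp e e' ▸ K.comp he he', fun x => (hn' _).trans (hn x)⟩

variable {p q r : K.NamedModel W}

/-- The strong embedding that preserves names. -/
noncomputable def emb (h : p ≤ q) : p.carrier ↪[L] q.carrier :=
  Exists.choose (show ∃ e : p.carrier ↪[L] q.carrier,
    K.Mor (ofEmbedding e) ∧ ∀ x, q.name (e x) = p.name x from h)

theorem mor_emb (h : p ≤ q) : K.Mor (ofEmbedding (emb h)) :=
  (Exists.choose_spec (show ∃ e : p.carrier ↪[L] q.carrier,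
    K.Mor (ofEmbedding e) ∧ ∀ x, q.name (e x) = p.name x from h)).1

@[simp] theorem name_emb (h : p ≤ q) (x : p.carrier) : q.name (emb h x) = p.name x :=
  (Exists.choose_spec (show ∃ e : p.carrier ↪[L] q.carrier,
    K.Mor (ofEmbedding e) ∧ ∀ x, q.name (e x) = p.name x from h)).2 x

theorem le_of_isStrongEmbedding {f : p.carrier ≃. q.carrier} (hf : K.IsStrongEmbedding f)
    (hn : ∀ x y, f x = some y → q.name y = p.name x) : p ≤ q := by
  obtain ⟨e, rfl⟩ := hf.exists_embedding
  exact ⟨e, hf.1, fun x => hn x _ rfl⟩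

/-- Unions of nonempty well-ordered chains of named models. -/
theorem exists_limit {ι : Type u} [LinearOrder ι] [WellFoundedLT ι] [Nonempty ι]
    (c : ι → K.NamedModel W) (hc : Monotone c) :
    ∃ D : K.NamedModel W, (∀ i, c i ≤ D) ∧ ∀ x, ∃ i y, D.name x = (c i).name y := by
  let G : ι → Type u := fun i => (c i).carrier
  let f : ∀ i j, i ≤ j → G i ↪[L] G j := fun i j h => emb (hc h)
  have hf : ∀ i j h x, (c j).name (f i j h x) = (c i).name x := fun i j h x => name_emb _ _
  -- The embeddings are arbitrarily chosen, but they commute because they preserve names and names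
  -- are injective.
  have : DirectedSystem G fun i j h => f i j h :=
    { map_self := fun i x => (c i).name_injective (hf i i le_rfl x)
      map_map := fun _ _ _ hij hjk _ => (c _).name_injective ((hf _ _ hjk _).trans
        ((hf _ _ hij _).trans (hf _ _ (hij.trans hjk) _).symm)) }
  let D := Language.DirectLimit G f
  let S : ι → L.Substructure D := fun i => (Language.DirectLimit.of L ι G f i).toHom.range
  let e : ∀ i, G i ≃[L] S i := fun i => (Language.DirectLimit.of L ι G f i).equivRange
  have hS : ∀ i, K.Obj (S i) := fun i =>
    obj_of_elementaryEmbedding (c i).obj (e i).toElementaryEmbedding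
  have hmor : ∀ i j, i < j →
      ∃ hij : S i ≤ S j, K.Mor (ofEmbedding (Substructure.inclusion hij)) := by
    intro i j hij
    have hle : S i ≤ S j := by
      rintro _ ⟨x, rfl⟩
      exact ⟨f i j hij.le x, Language.DirectLimit.of_f (hij := hij.le)⟩
    refine ⟨hle, ?_⟩
    have := K.comp (K.K2 (mor_of_equiv (c i).obj (e i)))
      (K.comp (mor_emb (hc hij.le)) (mor_of_equiv (c j).obj (e j)))
    convert this using 1
    refine PEquiv.ext fun x => ?_
    obtain ⟨y, rfl⟩ := (e i).surjective x
    rw [eq_comm]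
    refine (PEquiv.trans_eq_some _ _ _ _).2 ⟨y, (PEquiv.eq_some_iff _).2 rfl, ?_⟩
    refine (PEquiv.trans_eq_some _ _ _ _).2 ⟨f i j hij.le y, rfl, ?_⟩
    refine congrArg some (Subtype.ext ?_)
    exact Language.DirectLimit.of_f (hij := hij.le)
  obtain ⟨hD, hSD⟩ := K.In S hS hmor fun x => by
    obtain ⟨i, y, rfl⟩ := Language.DirectLimit.exists_of x
    exact ⟨i, y, rfl⟩
  have hof : ∀ i, K.Mor (ofEmbedding (Language.DirectLimit.of L ι G f i)) := fun i => by
    have := K.comp (mor_of_equiv (c i).obj (e i)) (hSD i)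
    convert this using 1
    exact PEquiv.ext fun _ => rfl
  choose k z hz using fun x : D => Language.DirectLimit.exists_of x
  -- The name of an element of the limit does not depend on the representative.
  have hname : ∀ i (x : G i), (c (k (Language.DirectLimit.of L ι G f i x))).name
      (z (Language.DirectLimit.of L ι G f i x)) = (c i).name x := by
    intro i x
    have h := hz (Language.DirectLimit.of L ι G f i x)
    set l := k (Language.DirectLimit.of L ι G f i x)
    set t := z (Language.DirectLimit.of L ι G f i x)
    rw [← Language.DirectLimit.of_f (hij := le_max_left l i), ← Language.DirectLimit.of_f (hij := le_max_right l i)]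
      at h
    have h' := congrArg (c (max l i)).name ((Language.DirectLimit.of L ι G f (max l i)).injective h)
    exact (hf _ _ (le_max_left l i) _).symm.trans (h'.trans (hf _ _ (le_max_right l i) _))
  refine ⟨⟨D, hD, fun x => (c (k x)).name (z x), ?_⟩, fun i => ?_, fun x => ⟨k x, z x, rfl⟩⟩
  · intro x y hxy
    have hxy' : (c (k x)).name (z x) = (c (k y)).name (z y) := hxy
    rw [← hz x, ← hz y, ← Language.DirectLimit.of_f (hij := le_max_left (k x) (k y)),
      ← Language.DirectLimit.of_f (hij := le_max_right (k x) (k y))]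
    congr 1
    exact (c _).name_injective ((hf _ _ (le_max_left _ _) _).trans
      (hxy'.trans (hf _ _ (le_max_right _ _) _).symm))
  · exact ⟨Language.DirectLimit.of L ι G f i, hof i, fun x => hname i x⟩

/-- A strong extension of the carrier of a named model can be named, with new names from a
given large set. -/
theorem exists_name (p : K.NamedModel W) {E : Type u} [L.Structure E] {j : p.carrier ≃. E}
    (R : Set W) (hE : #E ≤ #R) (hR : ∀ x, p.name x ∉ R) :
    ∃ name : E → W, Function.Injective name ∧ (∀ x y, j x = some y → name y = p.name x) ∧
      ∀ y, name y ∈ Set.range p.name ∪ R := by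
  classical
  obtain ⟨ι⟩ := hE
  let name : E → W := fun y => if h : ∃ x, j x = some y then p.name h.choose else ι y
  have h1 : ∀ x y, j x = some y → name y = p.name x := fun x y h => by
    have h' : ∃ x, j x = some y := ⟨x, h⟩
    simp only [name, dif_pos h']
    exact congrArg _ (j.inj h'.choose_spec h)
  have h2 : ∀ y, (¬ ∃ x, j x = some y) → name y = ι y := fun y h => dif_neg h
  refine ⟨name, fun y y' h => ?_, h1, fun y => ?_⟩
  · by_cases hy : ∃ x, j x = some y <;> by_cases hy' : ∃ x, j x = some y'
    · obtain ⟨x, hx⟩ := hy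
      obtain ⟨x', hx'⟩ := hy'
      rw [h1 _ _ hx, h1 _ _ hx'] at h
      obtain rfl := p.name_injective h
      exact Option.some_injective _ (hx.symm.trans hx')
    · obtain ⟨x, hx⟩ := hy
      rw [h1 _ _ hx, h2 _ hy'] at h
      exact absurd (h ▸ (ι y').2) (hR x)
    · obtain ⟨x, hx⟩ := hy'
      rw [h1 _ _ hx, h2 _ hy] at h
      exact absurd (h ▸ (ι y).2) (hR x)
    · rw [h2 _ hy, h2 _ hy'] at h
      exact ι.injective (Subtype.ext h)
  · by_cases hy : ∃ x, j x = some y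
    · obtain ⟨x, hx⟩ := hy
      exact Or.inl ⟨x, (h1 _ _ hx).symm⟩
    · rw [h2 _ hy]
      exact Or.inr (ι y).2

end NamedModel

end InductiveAmalgamationClass

/-! ### Cardinal bookkeeping for a construction of inaccessible length -/

namespace Cardinal

variable {μ : Cardinal.{u}}

theorem exists_mk_Iio_eq {B : Type u} (h : #B < μ) :
    ∃ a : μ.ord.ToType, #(Set.Iio a) = #B := by
  have h1 : (#B).ord < Ordinal.type (α := μ.ord.ToType) (· < ·) := by simpa using h
  refine ⟨Ordinal.enum (α := μ.ord.ToType) (· < ·) ⟨(#B).ord, h1⟩, ?_⟩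
  have := congrArg Ordinal.card (Ordinal.typein_enum (α := μ.ord.ToType) (· < ·) h1)
  rw [card_ord] at this
  exact this

theorem mk_Iio_ord_lt (i : μ.ord.ToType) : #(Set.Iio i) < μ :=
  (mk_Iio_lt i (by simp)).trans_eq (mk_ord_toType μ)

/-- Regularity. It places the range of a small morphism into a single stage of the chain. -/
theorem IsInaccessible.exists_gt (hμ : μ.IsInaccessible) {B : Type u} (h : #B < μ)
    (f : B → μ.ord.ToType) : ∃ i, ∀ b, f b < i := by
  have : ¬ IsCofinal (Set.range f) := fun hf => by
    have h1 := Order.cof_le hf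
    rw [Ordinal.cof_toType] at h1
    exact absurd (hμ.le_cof_ord.trans (h1.trans mk_range_le)) h.not_ge
  obtain ⟨i, hi⟩ := not_isCofinal_iff.1 this
  exact ⟨i, fun b => hi _ ⟨b, rfl⟩⟩

/-- A partition into large pieces. -/
theorem exists_rooms (hμ : ℵ₀ ≤ μ) :
    ∃ room : μ.ord.ToType → WithBot μ.ord.ToType, ∀ i, μ ≤ #{w | room w = i} := by
  have h : #(μ.ord.ToType) = #(WithBot μ.ord.ToType × μ.ord.ToType) := by
    have h1 : #(WithBot μ.ord.ToType) = μ := by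
      have : #(WithBot μ.ord.ToType) = #(Option μ.ord.ToType) := rfl
      rw [this, mk_option, mk_ord_toType, add_one_eq hμ]
    rw [mk_prod, lift_id, lift_id, h1, mk_ord_toType, mul_eq_self hμ]
  obtain ⟨e⟩ := Cardinal.eq.1 h
  refine ⟨fun w => (e w).1, fun i => ?_⟩
  refine (mk_ord_toType μ).ge.trans (mk_le_of_injective
    (f := fun w => (⟨e.symm (i, w), by simp⟩ : {w | (e w).1 = i})) fun a b hab => ?_)
  have := e.symm.injective (congrArg Subtype.val hab)
  exact (Prod.ext_iff.1 this).2

/-- An enumeration in which every element occurs cofinally often. -/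
theorem exists_enumeration (hμ : ℵ₀ ≤ μ) {T : Type*} {g : T → μ.ord.ToType}
    (hg : Function.Injective g) :
    ∃ τ : μ.ord.ToType → Option T, ∀ t j, ∃ i, j < i ∧ τ i = some t := by
  classical
  have h : #(μ.ord.ToType) = #(μ.ord.ToType × μ.ord.ToType) := by
    rw [mk_prod, lift_id, mk_ord_toType, mul_eq_self hμ]
  obtain ⟨e⟩ := Cardinal.eq.1 h
  refine ⟨fun i => if h : ∃ t, g t = (e i).1 then some h.choose else none, fun t j => ?_⟩
  -- The code of `t` is paired with `μ` many values of `w`, whereas fewer than `μ` indices are at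
  -- most `j`.
  have hex : ∃ w, j < e.symm (g t, w) := by
    by_contra hcon
    push Not at hcon
    have h1 : μ ≤ #(Set.Iic j) := (mk_ord_toType μ).ge.trans (mk_le_of_injective
      (f := fun w => (⟨e.symm (g t, w), hcon w⟩ : Set.Iic j)) fun a b hab => by
        have := e.symm.injective (congrArg Subtype.val hab)
        exact (Prod.ext_iff.1 this).2)
    have h2 : #(Set.Iic j) < μ := by
      rw [← Set.Iio_insert]
      exact mk_insert_le.trans_lt
        (add_lt_of_lt hμ (mk_Iio_ord_lt j) (one_lt_aleph0.trans_le hμ))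
    exact h1.not_gt h2
  obtain ⟨w, hw⟩ := hex
  refine ⟨_, hw, ?_⟩
  have h' : ∃ t', g t' = (e (e.symm (g t, w))).1 := ⟨t, by simp⟩
  refine (dif_pos h').trans ?_
  exact congrArg some (hg (h'.choose_spec.trans (by simp)))

end Cardinal

/-! ### Coding structures by sets -/

namespace FirstOrder.Language

variable (L : FirstOrder.Language.{v, w}) [Countable L.Symbols]

/-- A structure for a countable language is coded by a set of finite sequences. -/
theorem exists_structure_code (α : Type u) :
    ∃ code : L.Structure α → Set (ℕ × List α), Function.Injective code := by
  obtain ⟨enc, henc⟩ := exists_injective_nat L.Symbols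
  refine ⟨fun s => {z | (∃ (n : ℕ) (F : L.Functions n) (x : Fin n → α),
      z = (enc (Sum.inl ⟨n, F⟩), s.funMap F x :: List.ofFn x)) ∨
    ∃ (n : ℕ) (R : L.Relations n) (x : Fin n → α), s.RelMap R x ∧
      z = (enc (Sum.inr ⟨n, R⟩), List.ofFn x)}, fun s s' h => ?_⟩
  have key : ∀ s s' : L.Structure α, ({z | (∃ (n : ℕ) (F : L.Functions n) (x : Fin n → α),
      z = (enc (Sum.inl ⟨n, F⟩), s.funMap F x :: List.ofFn x)) ∨
      ∃ (n : ℕ) (R : L.Relations n) (x : Fin n → α), s.RelMap R x ∧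
        z = (enc (Sum.inr ⟨n, R⟩), List.ofFn x)} : Set (ℕ × List α)) ⊆
      {z | (∃ (n : ℕ) (F : L.Functions n) (x : Fin n → α),
        z = (enc (Sum.inl ⟨n, F⟩), s'.funMap F x :: List.ofFn x)) ∨
      ∃ (n : ℕ) (R : L.Relations n) (x : Fin n → α), s'.RelMap R x ∧
        z = (enc (Sum.inr ⟨n, R⟩), List.ofFn x)} →
      (∀ (n : ℕ) (F : L.Functions n) x, s.funMap F x = s'.funMap F x) ∧
      ∀ (n : ℕ) (R : L.Relations n) x, s.RelMap R x → s'.RelMap R x := by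
    intro s s' hss
    constructor
    · intro n F x
      rcases hss (Or.inl ⟨n, F, x, rfl⟩) with ⟨n', F', x', h⟩ | ⟨n', R', x', -, h⟩
      · obtain ⟨h1, h2⟩ := Prod.ext_iff.1 h
        have h3 := Sum.inl_injective (henc h1)
        obtain ⟨rfl, h3⟩ := Sigma.mk.inj_iff.1 h3
        obtain rfl := eq_of_heq h3
        obtain ⟨h4, h5⟩ := List.cons.inj h2
        obtain rfl := List.ofFn_injective h5
        exact h4
      · exact absurd (henc (Prod.ext_iff.1 h).1) (by simp)
    · intro n R x hx
      rcases hss (Or.inr ⟨n, R, x, hx, rfl⟩) with ⟨n', F', x', h⟩ | ⟨n', R', x', hx', h⟩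
      · exact absurd (henc (Prod.ext_iff.1 h).1) (by simp)
      · obtain ⟨h1, h2⟩ := Prod.ext_iff.1 h
        have h3 := Sum.inr_injective (henc h1)
        obtain ⟨rfl, h3⟩ := Sigma.mk.inj_iff.1 h3
        obtain rfl := eq_of_heq h3
        obtain rfl := List.ofFn_injective h2
        exact hx'
  have h1 := key s s' h.subset
  have h2 := key s' s h.superset
  apply Structure.ext
  · funext n F x
    exact h1.1 n F x
  · funext n R x
    exact propext ⟨h1.2 n R x, h2.2 n R x⟩

end FirstOrder.Language

/-! ### Extension tasks and the construction of weakly rich models -/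

namespace InductiveAmalgamationClass

/-- A code for a partial map from a structure on an initial segment of `W` to a named model:
the graph of the map is given in terms of names. -/
structure Task (L : FirstOrder.Language.{v, w}) (W : Type u) [Preorder W] where
  /-- The structure lives on the set of predecessors of this index. -/
  index : W
  /-- A bound for the names in the range of the map. -/
  bound : W
  /-- The structure. -/
  str : L.Structure (Set.Iio index)
  /-- The graph of the map. -/
  graph : Set (Set.Iio index × Set.Iio bound)

variable {L : FirstOrder.Language.{v, w}} {K : InductiveAmalgamationClass.{u, v, w} L}

/-- The domain of the partial map coded by a task. -/
def Task.Domain {W : Type u} [Preorder W] (t : Task L W) : Type u := Set.Iio t.index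

instance {W : Type u} [Preorder W] (t : Task L W) : L.Structure t.Domain := t.str

/-- Structure and graph are coded by subsets of sets of size less than `μ`. As `μ` is a strong
limit, there are fewer than `μ` of them for each of the `μ` many pairs of index and bound. -/
theorem exists_task_code [Countable L.Symbols] {μ : Cardinal.{u}} (hμ : μ.IsInaccessible) :
    ∃ g : Task L μ.ord.ToType → μ.ord.ToType, Function.Injective g := by
  choose code hcode using fun α : μ.ord.ToType => exists_structure_code L (Set.Iio α)
  let T := Σ (α : μ.ord.ToType) (β : μ.ord.ToType),
    Set (ℕ × List (Set.Iio α)) × Set (Set.Iio α × Set.Iio β)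
  let c : Task L μ.ord.ToType → T := fun t => ⟨t.index, t.bound, code _ t.str, t.graph⟩
  have hc : Function.Injective c := by
    rintro ⟨α, β, s, g⟩ ⟨α', β', s', g'⟩ h
    obtain ⟨rfl, h⟩ := Sigma.mk.inj_iff.1 h
    obtain ⟨rfl, h⟩ := Sigma.mk.inj_iff.1 (eq_of_heq h)
    obtain ⟨h1, h2⟩ := Prod.ext_iff.1 (eq_of_heq h)
    obtain rfl := hcode _ h1
    obtain rfl := h2
    rfl
  have hμ' : ℵ₀ ≤ μ := hμ.aleph0_lt.le
  have hT : #T ≤ #(μ.ord.ToType) := by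
    rw [mk_ord_toType]
    have h1 : ∀ α β : μ.ord.ToType,
        #(Set (ℕ × List (Set.Iio α)) × Set (Set.Iio α × Set.Iio β)) ≤ μ := by
      intro α β
      have hα := mk_Iio_ord_lt α
      have hβ := mk_Iio_ord_lt β
      rw [mk_prod, lift_id, lift_id, mk_set, mk_set]
      refine (mul_lt_of_lt hμ' (hμ.isStrongPrelimit ?_) (hμ.isStrongPrelimit ?_)).le
      · rw [mk_prod, lift_uzero, mk_nat, lift_aleph0]
        exact mul_lt_of_lt hμ' hμ.aleph0_lt ((mk_list_le_max _).trans_lt (max_lt hμ.aleph0_lt hα))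
      · rw [mk_prod, lift_id, lift_id]
        exact mul_lt_of_lt hμ' hα hβ
    have hsum : ∀ f : μ.ord.ToType → Cardinal.{u}, (∀ i, f i ≤ μ) → sum f ≤ μ := by
      intro f hf
      refine (sum_le_sum f (fun _ => μ) hf).trans ?_
      rw [sum_const', mk_ord_toType, mul_eq_self hμ']
    rw [mk_sigma]
    refine hsum _ fun α => ?_
    rw [mk_sigma]
    exact hsum _ fun β => h1 α β
  obtain ⟨e⟩ := hT
  exact ⟨e ∘ c, e.injective.comp hc⟩

namespace NamedModel

variable {W : Type u} [Preorder W]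

/-- If the task codes a morphism to `p`, that morphism extends to a strong embedding into `q`. -/
def Solves (t : Task L W) (p q : K.NamedModel W) : Prop :=
  ∀ f : t.Domain ≃. p.carrier, K.Mor f →
    (∀ (x : Set.Iio t.index) n, (x, n) ∈ t.graph ↔ ∃ y, f x = some y ∧ p.name y = n) →
    (∀ x y, f x = some y → p.name y < t.bound) →
    ∃ h : t.Domain ≃. q.carrier, K.IsStrongEmbedding h ∧
      ∀ x y, f x = some y → ∃ z, h x = some z ∧ q.name z = p.name y

/-- Names are preserved, so a morphism into an earlier stage has the same code as its composite into
a later one. Solving a task at the latest stage solves it for all earlier ones. -/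
theorem Solves.mono {t : Task L W} {p p' q : K.NamedModel W} (h : Solves t p q) (hp : p' ≤ p) :
    Solves t p' q := by
  intro f hf hg hb
  have key : ∀ x y, f.trans (ofEmbedding (emb hp)) x = some y ↔
      ∃ z, f x = some z ∧ emb hp z = y := fun x y =>
    (PEquiv.trans_eq_some _ _ _ _).trans (by simp)
  obtain ⟨k, hk, hk'⟩ := h (f.trans (ofEmbedding (emb hp))) (K.comp hf (mor_emb hp))
    (fun x n => by
      rw [hg]
      constructor
      · rintro ⟨y, hy, hn⟩
        exact ⟨emb hp y, (key _ _).2 ⟨y, hy, rfl⟩, by rw [name_emb, hn]⟩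
      · rintro ⟨y, hy, hn⟩
        obtain ⟨z, hz, rfl⟩ := (key _ _).1 hy
        exact ⟨z, hz, by rw [← hn, name_emb]⟩)
    (fun x y hxy => by
      obtain ⟨z, hz, rfl⟩ := (key _ _).1 hxy
      rw [name_emb]
      exact hb _ _ hz)
  refine ⟨k, hk, fun x y hxy => ?_⟩
  obtain ⟨z, hz, hz'⟩ := hk' x (emb hp y) ((key _ _).2 ⟨y, hxy, rfl⟩)
  exact ⟨z, hz, by rw [hz', name_emb]⟩

/-- A task codes at most one morphism into `p`, because names are injective. One amalgam solves it,
and the new elements take names from `R`. -/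
theorem exists_solves [Countable L.Symbols] (t : Task L W) (p : K.NamedModel W) (R : Set W)
    (hR : ∀ x, p.name x ∉ R) (ht : #t.Domain ≤ #R) (hp : #p.carrier ≤ #R) :
    ∃ q, p ≤ q ∧ Solves t p q ∧ ∀ y, q.name y ∈ Set.range p.name ∪ R := by
  by_cases hex : ∃ f : t.Domain ≃. p.carrier, K.Mor f ∧
    (∀ (x : Set.Iio t.index) n, (x, n) ∈ t.graph ↔ ∃ y, f x = some y ∧ p.name y = n) ∧
    (∀ x y, f x = some y → p.name y < t.bound)
  · obtain ⟨f, hf, hg, hb⟩ := hex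
    obtain ⟨E, _, j, h, hj, hh, hle, hE⟩ := exists_amalgam hf ht hp
    obtain ⟨name, hinj, hname, hran⟩ := p.exists_name (j := j) R hE hR
    let q : K.NamedModel W := ⟨E, (K.obj_of_mor hj.1).2, name, hinj⟩
    refine ⟨q, le_of_isStrongEmbedding (q := q) hj hname, ?_, hran⟩
    intro f' hf' hg' hb'
    refine ⟨h, hh, fun x y hxy => ?_⟩
    obtain ⟨y', hy', hn⟩ := (hg x ⟨p.name y, hb' x y hxy⟩).1 ((hg' _ _).2 ⟨y, hxy, rfl⟩)
    obtain rfl := p.name_injective hn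
    exact ⟨hj.2.fn y', le_iff.1 hle _ _
      ((PEquiv.trans_eq_some _ _ _ _).2 ⟨y', hy', hj.2.apply y'⟩), hname _ _ (hj.2.apply y')⟩
  · exact ⟨p, le_rfl, fun f hf hg hb => absurd ⟨f, hf, hg, hb⟩ hex, fun y => Or.inl ⟨y, rfl⟩⟩

end NamedModel

open NamedModel

/-- Every model of cardinality at most `μ` has a strong extension that is weakly rich at `μ`. -/
theorem exists_isWeaklyRichAt [Countable L.Symbols] {μ : Cardinal.{u}} (hμ : μ.IsInaccessible)
    {A : Type u} [L.Structure A] (hA : K.Obj A) (hcard : #A ≤ μ) :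
    ∃ (U : Type u) (_ : L.Structure U) (j : A ≃. U),
      K.IsWeaklyRichAt μ U ∧ #U = μ ∧ K.IsStrongEmbedding j := by
  have hμ' : ℵ₀ ≤ μ := hμ.aleph0_lt.le
  have := K.infinite_of_obj hA
  -- Starting from size exactly `μ` ensures that the final model has cardinality `μ`.
  obtain ⟨A', _, ⟨e⟩, hA'⟩ := exists_elementaryEmbedding_mk_eq (L := L) A hcard
  obtain ⟨g, hg⟩ := exists_task_code (L := L) hμ
  obtain ⟨τ, hτ⟩ := exists_enumeration hμ' hg
  -- The bottom room holds the names of the starting model, room `i` those introduced at stage `i`.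
  -- Fresh names are thus always available.
  obtain ⟨room, hroom⟩ := exists_rooms hμ'
  obtain ⟨ν⟩ : #A' ≤ #{w | room w = ⊥} := hA'.trans_le (hroom ⊥)
  let base : K.NamedModel μ.ord.ToType := ⟨A', obj_of_elementaryEmbedding hA e, fun x => ν x,
    fun x y h => ν.injective (Subtype.ext h)⟩
  have hcar : ∀ p : K.NamedModel μ.ord.ToType, #p.carrier ≤ μ := fun p =>
    (mk_le_of_injective p.name_injective).trans_eq (mk_ord_toType μ)
  have : Nonempty (K.NamedModel μ.ord.ToType) := ⟨base⟩
  obtain ⟨c, hc, hQ, hR⟩ := exists_monotone_of_wellFoundedLT (W := μ.ord.ToType)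
    (P := K.NamedModel μ.ord.ToType)
    (fun i q => base ≤ q ∧ ∀ y, room (q.name y) ≤ i)
    (fun i p q => ∀ t, τ i = some t → Solves t p q) (by
      intro i c hc hQ
      obtain ⟨D, hbD, hcD, hD⟩ : ∃ D : K.NamedModel μ.ord.ToType, base ≤ D ∧ (∀ j, c j ≤ D) ∧
          ∀ y, room (D.name y) < i := by
        rcases isEmpty_or_nonempty (Set.Iio i) with hi | hi
        · refine ⟨base, le_rfl, fun j => hi.elim j, fun y => ?_⟩
          rw [show room (base.name y) = ⊥ from (ν y).2]
          exact WithBot.bot_lt_coe i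
        · obtain ⟨D, hD, hn⟩ := exists_limit c hc
          refine ⟨D, (hQ hi.some).1.trans (hD _), hD, fun y => ?_⟩
          obtain ⟨j, z, hz⟩ := hn y
          rw [hz]
          exact ((hQ j).2 z).trans_lt (WithBot.coe_lt_coe.2 j.2)
      cases hτi : τ i with
      | none =>
        exact ⟨D, ⟨hbD, fun y => (hD y).le⟩, fun j => ⟨hcD j, fun t ht => by simp at ht⟩⟩
      | some t =>
        obtain ⟨q, hDq, hsol, hran⟩ := exists_solves t D {w | room w = i}
          (fun x hx => (hD x).ne hx)
          ((show #t.Domain < μ from mk_Iio_ord_lt t.index).le.trans (hroom i))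
          ((hcar D).trans (hroom i))
        refine ⟨q, ⟨hbD.trans hDq, fun y => ?_⟩, fun j => ⟨(hcD j).trans hDq, ?_⟩⟩
        · rcases hran y with ⟨x, hx⟩ | hy
          · rw [← hx]
            exact (hD x).le
          · exact le_of_eq hy
        · rintro t' ht'
          obtain rfl := Option.some_injective _ ht'
          exact hsol.mono (hcD j))
  have : Nonempty μ.ord.ToType := mk_ne_zero_iff.1 (by rw [mk_ord_toType]; exact hμ.ne_zero)
  obtain ⟨D, hcD, hD⟩ := exists_limit c hc
  have hbD : base ≤ D := (hQ (Classical.arbitrary _)).1.trans (hcD _)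
  refine ⟨D.carrier, inferInstance, (ofEmbedding e.toEmbedding).trans (ofEmbedding (emb hbD)),
    ⟨D.obj, ?_⟩, (hcar D).antisymm ?_,
    (isStrongEmbedding_of_elementaryEmbedding hA e).trans ⟨mor_emb hbD, isTotal_ofEmbedding _⟩⟩
  · intro B _ f hf hB
    obtain ⟨α, hα⟩ := exists_mk_Iio_eq hB
    obtain ⟨b⟩ := Cardinal.eq.1 hα.symm
    have hBobj := (K.obj_of_mor hf).1
    have hdom : #(dom f) < μ := (mk_set_le _).trans_lt hB
    choose y hy using fun x : dom f => x.2
    choose l z hz using fun x : dom f => hD (y x)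
    -- All values of `f` appear by stage `j`, with names below `β`.
    obtain ⟨j, hj⟩ := hμ.exists_gt hdom l
    obtain ⟨β, hβ⟩ := hμ.exists_gt hdom fun x => D.name (y x)
    have hyj : ∀ x, ∃ s : (c j).carrier, emb (hcD j) s = y x := fun x =>
      ⟨emb (hc (hj x).le) (z x), D.name_injective (by rw [name_emb, name_emb, hz])⟩
    let str : L.Structure (Set.Iio α) := b.inducedStructure
    let t₀ : Task L μ.ord.ToType := ⟨α, β, str, ∅⟩
    let b' : B ≃[L] t₀.Domain := b.inducedStructureEquiv
    let k : t₀.Domain ≃. (c j).carrier :=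
      (ofEmbedding b'.symm.toEmbedding).trans (f.trans (ofEmbedding (emb (hcD j))).symm)
    have hk : K.Mor k :=
      K.comp (mor_of_equiv (obj_of_elementaryEmbedding hBobj b'.toElementaryEmbedding) b'.symm)
        (K.comp hf (K.K2 (mor_emb _)))
    have hk' : ∀ x s, k x = some s ↔ f (b'.symm x) = some (emb (hcD j) s) := fun x s => by
      refine (PEquiv.trans_eq_some _ _ _ _).trans ⟨?_, fun h => ?_⟩
      · rintro ⟨x', hx', h⟩
        obtain rfl := Option.some_injective _ hx'
        obtain ⟨d, hd, hds⟩ := (PEquiv.trans_eq_some _ _ _ _).1 h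
        rw [PEquiv.eq_some_iff] at hds
        obtain rfl := Option.some_injective _ hds
        exact hd
      · exact ⟨_, rfl, (PEquiv.trans_eq_some _ _ _ _).2 ⟨_, h, (PEquiv.eq_some_iff _).2 rfl⟩⟩
    let t : Task L μ.ord.ToType := ⟨α, β, str, {xn | ∃ s, k xn.1 = some s ∧ (c j).name s = xn.2}⟩
    obtain ⟨i, hji, hi⟩ := hτ t j
    obtain ⟨h, hh, hle⟩ := hR j i hji t hi k hk (fun x n => Iff.rfl) (fun x s hxs => by
      have h1 := (hk' _ _).1 hxs
      have h2 := hβ ⟨_, _, h1⟩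
      have h3 := Option.some_injective _ ((hy ⟨_, _, h1⟩).symm.trans h1)
      rw [h3, name_emb] at h2
      exact h2)
    refine ⟨(ofEmbedding b'.toEmbedding).trans (h.trans (ofEmbedding (emb (hcD i)))),
      ⟨K.comp (mor_of_equiv hBobj b') (K.comp hh.1 (mor_emb _)),
        (isTotal_ofEmbedding _).trans (hh.2.trans (isTotal_ofEmbedding _))⟩,
      le_iff.2 fun x d hxd => ?_⟩
    obtain ⟨s, hs⟩ := hyj ⟨x, d, hxd⟩
    have h3 := Option.some_injective _ ((hy ⟨x, d, hxd⟩).symm.trans hxd)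
    obtain ⟨r, hr, hrn⟩ := hle (b' x) s ((hk' _ _).2 (by
      rw [Language.Equiv.symm_apply_apply, hs, h3, hxd]))
    refine (PEquiv.trans_eq_some _ _ _ _).2 ⟨_, rfl,
      (PEquiv.trans_eq_some _ _ _ _).2 ⟨r, hr, congrArg some (D.name_injective ?_)⟩⟩
    rw [name_emb, hrn, ← h3, ← hs, name_emb]
  · exact hA'.ge.trans (mk_le_of_injective (emb hbD).injective)

/-! ### Rich models of inaccessible cardinality -/

section Rich

variable {L : FirstOrder.Language.{v, w}} [Countable L.Symbols]
  {K : InductiveAmalgamationClass.{u, v, w} L}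

/-- Weakly rich models of inaccessible cardinality are rich. -/
theorem IsWeaklyRichAt.isRich {μ : Cardinal.{u}} (hμ : μ.IsInaccessible) {U : Type u}
    [L.Structure U] (hU : K.IsWeaklyRichAt μ U) (hcard : #U = μ) : K.IsRich U := by
  refine ⟨hU.1, fun N _ f hf hd hN => ?_⟩
  rw [hcard] at hN
  obtain ⟨V, _, j, hV, hVcard, hj⟩ := exists_isWeaklyRichAt hμ (K.obj_of_mor hf).1 hN
  have hel : ∀ g : V ≃. U, K.Mor g → IsElementaryMap L g := fun g hg =>
    isElementaryMap_of_hasFiniteExtension (hU.hasFiniteExtension hμ.aleph0_lt)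
      (hV.hasFiniteExtension hμ.aleph0_lt) hg
  -- Weak richness adds one point at a time. The extensions are again elementary by `hel`, so limit
  -- stages cause no trouble.
  obtain ⟨g, hfg, hg, hdom⟩ := IsElementaryMap.exists_extension (L := L) hμ.aleph0_lt.le
    (fun g hg hd a => by
      obtain ⟨k, hk, hgk, ha⟩ :=
        hU.exists_extension hμ.aleph0_lt (K.K1 hV.1 hU.1 hg) hd a
      exact ⟨k, hgk, hel k hk, ha⟩)
    (hel (j.symm.trans f) (K.comp (K.K2 hj.1) hf))
    ((mk_dom_trans_le_right _ _).trans_lt (hd.trans_le hN)) Set.univ (by rw [mk_univ, hVcard])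
  refine ⟨j.trans g, ⟨K.comp hj.1 (K.K1 hV.1 hU.1 hg), hj.2.trans fun a => hdom trivial⟩,
    le_iff.2 fun a b hab => ?_⟩
  refine (PEquiv.trans_eq_some _ _ _ _).2 ⟨_, hj.2.apply a, le_iff.1 hfg _ _ ?_⟩
  exact (PEquiv.trans_eq_some _ _ _ _).2 ⟨a, (PEquiv.eq_some_iff _).2 (hj.2.apply a), hab⟩

/-- Every model has a strong extension that is rich, of any given larger inaccessible
cardinality. -/
theorem exists_isRich {μ : Cardinal.{u}} (hμ : μ.IsInaccessible) {M : Type u} [L.Structure M]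
    (hM : K.Obj M) (hcard : #M ≤ μ) :
    ∃ (U : Type u) (_ : L.Structure U) (j : M ≃. U),
      K.IsRich U ∧ #U = μ ∧ K.IsStrongEmbedding j := by
  obtain ⟨U, _, j, hU, hUcard, hj⟩ := exists_isWeaklyRichAt hμ hM hcard
  exact ⟨U, _, j, hU.isRich hμ hUcard, hUcard, hj⟩

end Rich

/-! ### Saturated models as rich models of the class of elementary maps -/

section ElementaryClass

variable {L : FirstOrder.Language.{v, w}}

/-- The union of an elementary chain of substructures is an elementary extension of each of them. -/
theorem realize_iff_of_elementary_chain {M : Type u} [L.Structure M] {ι : Type*} [LinearOrder ι]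
    (S : ι → L.Substructure M)
    (hS : ∀ i j, i < j → ∃ hij : S i ≤ S j,
      IsElementaryMap L (ofEmbedding (Substructure.inclusion hij)))
    (hM : ∀ x : M, ∃ i, x ∈ S i) {m n : ℕ} (φ : L.BoundedFormula (Fin m) n) :
    ∀ i (a : Fin m → S i) (x : Fin n → S i),
      (φ.Realize a x ↔ φ.Realize (fun k => (a k : M)) fun k => (x k : M)) := by
  induction φ with
  | falsum => exact fun _ _ _ => Iff.rfl
  | equal t₁ t₂ =>
    intro i a x
    have h : (Sum.elim (fun k => (a k : M)) fun k => (x k : M)) = (S i).subtype ∘ Sum.elim a x := by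
      funext k
      cases k <;> rfl
    simp only [BoundedFormula.Realize]
    rw [h, HomClass.realize_term, HomClass.realize_term]
    exact (S i).subtype.injective.eq_iff.symm
  | rel R ts =>
    intro i a x
    have h : (Sum.elim (fun k => (a k : M)) fun k => (x k : M)) = (S i).subtype ∘ Sum.elim a x := by
      funext k
      cases k <;> rfl
    simp only [BoundedFormula.Realize]
    rw [h]
    simp only [HomClass.realize_term]
    exact ((S i).subtype.map_rel R _).symm
  | imp φ ψ ih₁ ih₂ =>
    intro i a x
    rw [BoundedFormula.realize_imp, BoundedFormula.realize_imp, ih₁, ih₂]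
  | all φ ih =>
    intro i a x
    rw [BoundedFormula.realize_all, BoundedFormula.realize_all]
    have snoc : ∀ {p : ℕ} j (y : Fin p → S j) (c : S j),
        (fun k => ((Fin.snoc y c : Fin (p + 1) → S j) k : M)) =
        Fin.snoc (fun k => (y k : M)) (c : M) := by
      intro p j y c
      funext k
      refine Fin.lastCases ?_ (fun k => ?_) k <;> simp
    constructor
    · intro h c
      obtain ⟨j, hj⟩ := hM c
      -- The universal statement is carried up from stage `i` to a stage that contains the witness
      -- `c`.
      have key : ∀ k (hik : i ≤ k) (hc : c ∈ S k), φ.Realize (fun k => (a k : M))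
          (Fin.snoc (fun k => (x k : M)) c) := by
        intro k hik hc
        rcases hik.lt_or_eq with hik | rfl
        · obtain ⟨hle, hel⟩ := hS i k hik
          have h1 := (hel.realize_iff φ.all.toFormula (a := Sum.elim a x)
            (b := fun s => Substructure.inclusion hle (Sum.elim a x s)) (fun _ => rfl)).1
            (by rw [BoundedFormula.realize_toFormula, BoundedFormula.realize_all]; exact h)
          rw [BoundedFormula.realize_toFormula, BoundedFormula.realize_all] at h1
          have h2 := (ih k _ _).1 (h1 ⟨c, hc⟩)
          rw [snoc] at h2
          exact h2
        · have h2 := (ih i _ _).1 (h ⟨c, hc⟩)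
          rw [snoc] at h2
          exact h2
      rcases le_total i j with hij | hji
      · exact key j hij hj
      · rcases hji.lt_or_eq with hji | rfl
        · exact key i le_rfl ((hS j i hji).1 hj)
        · exact key _ le_rfl hj
    · intro h c
      have h2 := h c
      rw [← snoc] at h2
      exact (ih i _ _).2 h2

/-- Elementary amalgamation. -/
theorem exists_elementary_amalgam [Countable L.Symbols] {M N : Type u} [L.Structure M]
    [L.Structure N] [Infinite N] {f : M ≃. N} (hf : IsElementaryMap L f) :
    ∃ (N' : Type u) (_ : L.Structure N') (j : N ↪ₑ[L] N') (h : M ≃. N'),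
      IsElementaryMap L h ∧ IsTotal h ∧ f.trans (ofEmbedding j.toEmbedding) ≤ h := by
  choose r hr using fun a : dom f => a.2
  -- The elementary diagram of `M`, with one variable for each element and with the points of `dom
  -- f` also named as parameters.
  obtain ⟨N', _, j, y, hy⟩ := exists_elementaryEmbedding_realize (L := L) r
    {φ : L.Formula (dom f ⊕ M) | φ.Realize (Sum.elim (fun a : dom f => (a : M)) id)} (by
      intro q hq hfin
      have : Finite q := hfin
      obtain ⟨y, hy⟩ := hf.exists_realize (Formula.iInf fun φ : q => φ.1) hr (x := id)
        (Formula.realize_iInf.2 fun φ => hq φ.2)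
      exact ⟨y, fun φ hφ => Formula.realize_iInf.1 hy ⟨φ, hφ⟩⟩)
  obtain ⟨h, hh, hG⟩ := exists_isElementaryMap_of_graph (L := L) (fun a b => b = y a) (by
    intro n φ a b hab ha
    have := hy (φ.relabel (Sum.inr ∘ a)) (by
      change Formula.Realize _ _
      rw [Formula.realize_relabel]
      exact ha)
    rw [Formula.realize_relabel] at this
    rw [funext hab]
    exact this)
  refine ⟨N', _, j, h, hh, fun a => ⟨y a, (hG _ _).2 rfl⟩, le_iff.2 fun a c hac => ?_⟩
  obtain ⟨b, hb, hbc⟩ := (PEquiv.trans_eq_some _ _ _ _).1 hac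
  obtain rfl := Option.some_injective _ hbc
  rw [hG]
  -- The diagram says that the parameter `a` equals the variable `a`, so the new map extends `f`.
  have h1 := hy ((Term.var (Sum.inl ⟨a, b, hb⟩)).equal (Term.var (Sum.inr a))) (by
    change Formula.Realize _ _
    simp [Formula.realize_equal])
  simp only [Formula.realize_equal, Term.realize_var, Sum.elim_inl, Sum.elim_inr,
    Function.comp_apply] at h1
  rw [← h1]
  exact congrArg j (Option.some_injective _ (hb.symm.trans (hr ⟨a, b, hb⟩)))

variable (L) in
/-- The class of all infinite structures, with elementary maps as morphisms. -/
noncomputable def elementaryClass [Countable L.Symbols] :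
    InductiveAmalgamationClass.{u, v, w} L where
  Obj M _ := Infinite M
  Mor {M N} _ _ f := Infinite M ∧ Infinite N ∧ IsElementaryMap L f
  infinite_of_obj h := h
  obj_of_mor h := ⟨h.1, h.2.1⟩
  isPartialEmbedding_of_mor h := fun n φ _ a b hab => h.2.2 n φ a b hab
  comp hf hg := ⟨hf.1, hg.2.1, hf.2.2.trans hg.2.2⟩
  K0 hM h := h.infinite_iff.1 hM
  K1 hM hN h := ⟨hM, hN, h⟩
  K2 h := ⟨h.2.1, h.1, h.2.2.symm⟩
  R h hle := ⟨h.1, h.2.1, h.2.2.mono hle⟩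
  Ap {M N _ _ f} h := by
    have := h.2.1
    obtain ⟨N', _, j, k, hk, hkt, hle⟩ := exists_elementary_amalgam h.2.2
    have : Infinite N' := Infinite.of_injective _ j.injective
    exact ⟨N', _, _, k, ⟨⟨h.2.1, this, isElementaryMap_ofEmbedding j⟩, isTotal_ofEmbedding _⟩,
      ⟨⟨h.1, this, hk⟩, hkt⟩, hle⟩
  In {M _ ι _ _ _} S hS hmor hM := by
    have hinf : Infinite M := by
      have := hS (Classical.arbitrary ι)
      exact Infinite.of_injective _ (S (Classical.arbitrary ι)).subtype.injective
    refine ⟨hinf, fun i => ⟨hS i, hinf, fun n φ a b hab => ?_⟩⟩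
    have hb : b = fun k => (a k : M) := funext fun k => (Option.some_injective _ (hab k)).symm
    rw [hb]
    have := realize_iff_of_elementary_chain S
      (fun i j hij => ⟨(hmor i j hij).1, (hmor i j hij).2.2.2⟩) hM φ i a default
    rw [Formula.Realize, Formula.Realize, this]
    congr!

/-- Existence of saturated elementary extensions of inaccessible cardinality. -/
theorem exists_isSaturated [Countable L.Symbols] {μ : Cardinal.{u}} (hμ : μ.IsInaccessible)
    {M : Type u} [L.Structure M] [hM : Infinite M] (hcard : #M ≤ μ) :
    ∃ (U : Type u) (_ : L.Structure U), Nonempty (M ↪ₑ[L] U) ∧ IsSaturated L U := by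
  obtain ⟨U, _, j, hU, hUcard, hj⟩ := exists_isRich (K := elementaryClass L) hμ hM hcard
  exact ⟨U, _, ⟨hj.1.2.2.toElementaryEmbedding hj.2⟩,
    IsRichAt.isSaturatedAt hU.aleph0_le hU fun _ _ _ _ hf => hf.2.2⟩

end ElementaryClass

end InductiveAmalgamationClass

/-! ### Statement 4 and its equivalents -/

namespace InductiveAmalgamationClass

variable {L : FirstOrder.Language.{v, w}} {K : InductiveAmalgamationClass.{u, v, w} L}
  {M N U : Type u} [L.Structure M] [L.Structure N] [L.Structure U]

theorem IsRich.isRichTheoryModel (hU : K.IsRich U) : K.IsRichTheoryModel U :=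
  ⟨hU.1, ⟨fun _ hφ => hφ U hU⟩⟩

theorem IsRichTheoryModel.of_equiv (hM : K.IsRichTheoryModel M) (h : M ≅[L] N) :
    K.IsRichTheoryModel N :=
  ⟨K.K0 hM.1 h, h.theory_model_iff.1 hM.2⟩

/-- In a full class every model of the theory of the rich models is elementarily equivalent to a
rich model. -/
theorem IsFull.exists_isRich_equiv (hK : K.IsFull) (hM : K.IsRichTheoryModel M) :
    ∃ (U : Type u) (_ : L.Structure U), K.IsRich U ∧ (M ≅[L] U) := by
  obtain ⟨U, _, hU, hMU⟩ := hK M hM.1 fun φ hφ => by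
    -- A sentence that fails in every rich model has its negation in the theory of the rich models.
    by_contra hcon
    push Not at hcon
    have : φ.not ∈ K.richTheory := fun U _ hU => Sentence.realize_not U |>.2 (hcon U _ hU)
    exact (Sentence.realize_not M).1 (hM.2.realize_of_mem _ this) hφ
  refine ⟨U, _, hU, elementarilyEquivalent_iff.2 fun φ => ⟨fun h => ?_, fun h => ?_⟩⟩
  · exact hMU.realize_of_mem φ h
  · by_contra h'
    exact (Sentence.realize_not U).1
      (hMU.realize_of_mem φ.not ((Sentence.realize_not M).2 h')) h

variable (K) in
/-- Finite tuples of `M` are mapped to a rich model by elementary maps. -/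
def IsFinitelyRichlyEmbeddable (M : Type u) [L.Structure M] : Prop :=
  ∀ (n : ℕ) (a : Fin n → M), ∃ (U : Type u) (_ : L.Structure U) (j : M ≃. U),
    K.IsRich U ∧ IsElementaryMap L j ∧ ∀ i, a i ∈ dom j

/-- The empty map is elementary, and by `ℵ₀`-saturation it extends to any finite tuple. -/
theorem isFinitelyRichlyEmbeddable_of_isSaturatedAt (hU : K.IsRich U) (hsat : IsSaturatedAt L ℵ₀ U)
    (hMU : M ≅[L] U) : K.IsFinitelyRichlyEmbeddable M := by
  intro n a
  have := K.infinite_of_obj hU.1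
  obtain ⟨j, -, hj, hd⟩ := IsElementaryMap.exists_extension (L := L) le_rfl
    (fun g hg hd a => hsat.exists_extension hg hd a) (isElementaryMap_bot hMU)
    (by
      have : dom (⊥ : M ≃. U) = ∅ := by
        ext x
        simp [dom]
      rw [this, mk_eq_zero]
      exact aleph0_pos)
    (Set.range a) (mk_le_aleph0_iff.2 (Set.finite_range a).countable.to_subtype)
  exact ⟨U, _, j, hU, hj, fun i => hd ⟨i, rfl⟩⟩

variable [Countable L.Symbols]

/-- Conjugating `f` by elementary maps that carry `a` and `b` into rich models gives a morphism
between rich models, which is elementary. -/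
theorem isElementaryMap_of_isFinitelyRichlyEmbeddable (hM : K.IsFinitelyRichlyEmbeddable M)
    (hN : K.IsFinitelyRichlyEmbeddable N) {f : M ≃. N} (hf : K.Mor f) : IsElementaryMap L f := by
  intro n φ a b hab
  obtain ⟨hMo, hNo⟩ := K.obj_of_mor hf
  obtain ⟨U, _, j, hU, hj, hja⟩ := hM n a
  obtain ⟨V, _, k, hV, hk, hkb⟩ := hN n b
  choose c hc using hja
  choose d hd using hkb
  have hel : IsElementaryMap L (j.symm.trans (f.trans k)) :=
    IsRichAt.isElementaryMap hU.aleph0_le hV.aleph0_le hU hV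
      (K.comp (K.K2 (K.K1 hMo hU.1 hj)) (K.comp hf (K.K1 hNo hV.1 hk)))
  rw [hj n φ a c hc, hk n φ b d hd]
  refine hel n φ c d fun i => ?_
  exact (PEquiv.trans_eq_some _ _ _ _).2 ⟨a i, (PEquiv.eq_some_iff _).2 (hc i),
    (PEquiv.trans_eq_some _ _ _ _).2 ⟨b i, hab i, hd i⟩⟩

theorem exists_isRich_ge
    (inaccessibles : ∀ κ : Cardinal.{u}, ∃ μ : Cardinal.{u}, κ < μ ∧ μ.IsInaccessible)
    (hM : K.Obj M) (κ : Cardinal.{u}) :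
    ∃ (U : Type u) (_ : L.Structure U) (j : M ≃. U),
      K.IsRich U ∧ κ ≤ #U ∧ K.IsStrongEmbedding j := by
  obtain ⟨μ, hlt, hμ⟩ := inaccessibles (max #M κ)
  obtain ⟨U, _, j, hU, hcard, hj⟩ := exists_isRich hμ hM ((le_max_left _ _).trans hlt.le)
  exact ⟨U, _, j, hU, hcard ▸ (le_max_right _ _).trans hlt.le, hj⟩

/-- A `κ`-rich model need not be rich. It has a strong embedding into a rich model, which is
elementary by back and forth and so preserves the theory. -/
theorem IsRichAt.isRichTheoryModel
    (inaccessibles : ∀ κ : Cardinal.{u}, ∃ μ : Cardinal.{u}, κ < μ ∧ μ.IsInaccessible)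
    {κ : Cardinal.{u}} (hκ : ℵ₀ ≤ κ) (hU : K.IsRichAt κ U) :
    K.IsRichTheoryModel U := by
  obtain ⟨V, _, j, hV, -, hj⟩ := exists_isRich_ge inaccessibles hU.1 ℵ₀
  exact hV.isRichTheoryModel.of_equiv
    (hU.isElementaryMap hκ hV.aleph0_le hV hj.1).elementarilyEquivalent.symm

theorem IsRichAt.isSaturatedAt_of_forall_isElementaryMap
    (inaccessibles : ∀ κ : Cardinal.{u}, ∃ μ : Cardinal.{u}, κ < μ ∧ μ.IsInaccessible)
    (hel : ∀ (M N : Type u) [L.Structure M] [L.Structure N] (f : M ≃. N),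
      K.IsRichTheoryModel M → K.IsRichTheoryModel N → K.Mor f → IsElementaryMap L f)
    {κ : Cardinal.{u}} (hκ : ℵ₀ ≤ κ) (hU : K.IsRichAt κ U) : IsSaturatedAt L κ U :=
  have hU' := hU.isRichTheoryModel inaccessibles hκ
  hU.isSaturatedAt hκ fun M _ hM f hf => hel M U f (hU'.of_equiv hM.symm) hU' hf

/-- The source need not satisfy the theory of the rich models, so it is first embedded in a rich
`V`. Saturation then extends the map over the image of the source only, as `V` may be larger than
`M`. -/
theorem isRich_of_isSaturated
    (inaccessibles : ∀ κ : Cardinal.{u}, ∃ μ : Cardinal.{u}, κ < μ ∧ μ.IsInaccessible)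
    (hel : ∀ (M N : Type u) [L.Structure M] [L.Structure N] (f : M ≃. N),
      K.IsRichTheoryModel M → K.IsRichTheoryModel N → K.Mor f → IsElementaryMap L f)
    (hM : K.IsRichTheoryModel M) (hsat : IsSaturated L M) : K.IsRich M := by
  refine ⟨hM.1, fun N _ f hf hd hN => ?_⟩
  have := K.infinite_of_obj hM.1
  obtain ⟨V, _, j, hV, -, hj⟩ := exists_isRich_ge inaccessibles (K.obj_of_mor hf).1 ℵ₀
  have hf' : K.Mor (j.symm.trans f) := K.comp (K.K2 hj.1) hf
  obtain ⟨g, hfg, hg, hdom⟩ := IsElementaryMap.exists_extension (L := L) (aleph0_le_mk M)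
    (fun g hg hd a => hsat.exists_extension hg hd a) (hel V M _ hV.isRichTheoryModel hM hf')
    ((mk_dom_trans_le_right _ _).trans_lt (hd.trans_le hN)) (Set.range hj.2.fn)
    (mk_range_le.trans hN)
  refine ⟨j.trans g, ⟨K.comp hj.1 (K.K1 hV.1 hM.1 hg), fun a => ?_⟩, le_iff.2 fun a b hab => ?_⟩
  · obtain ⟨b, hb⟩ := hdom ⟨a, rfl⟩
    exact ⟨b, (PEquiv.trans_eq_some _ _ _ _).2 ⟨_, hj.2.apply a, hb⟩⟩
  · refine (PEquiv.trans_eq_some _ _ _ _).2 ⟨_, hj.2.apply a, le_iff.1 hfg _ _ ?_⟩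
    exact (PEquiv.trans_eq_some _ _ _ _).2 ⟨a, (PEquiv.eq_some_iff _).2 (hj.2.apply a), hab⟩

theorem isFinitelyRichlyEmbeddable_of_forall_isRich
    (inaccessibles : ∀ κ : Cardinal.{u}, ∃ μ : Cardinal.{u}, κ < μ ∧ μ.IsInaccessible)
    (hrich : ∀ (M : Type u) [L.Structure M], K.IsRichTheoryModel M → IsSaturated L M → K.IsRich M)
    (hM : K.IsRichTheoryModel M) : K.IsFinitelyRichlyEmbeddable M := by
  intro n a
  have := K.infinite_of_obj hM.1
  obtain ⟨μ, hlt, hμ⟩ := inaccessibles #M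
  obtain ⟨U, _, ⟨e⟩, hU⟩ := exists_isSaturated (L := L) hμ hlt.le
  exact ⟨U, _, _, hrich U (hM.of_equiv e.elementarilyEquivalent) hU,
    isElementaryMap_ofEmbedding e, fun i => isTotal_ofEmbedding _ _⟩

/-- Inside a rich model that contains an amalgam, `f` becomes part of one strong embedding followed
by the inverse of another. -/
theorem isElementaryMap_of_isStrongSubmodel_iff
    (inaccessibles : ∀ κ : Cardinal.{u}, ∃ μ : Cardinal.{u}, κ < μ ∧ μ.IsInaccessible)
    (hsub : ∀ (N : Type u) [L.Structure N] (S : L.Substructure N),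
      K.IsRichTheoryModel S → K.IsRichTheoryModel N → (K.IsStrongSubmodel S ↔ S.IsElementary))
    (hM : K.IsRichTheoryModel M) (hN : K.IsRichTheoryModel N) {f : M ≃. N} (hf : K.Mor f) :
    IsElementaryMap L f := by
  -- The hypothesis concerns substructures, so a strong embedding is replaced by the inclusion of
  -- its image.
  have key : ∀ {A B : Type u} [L.Structure A] [L.Structure B] {h : A ≃. B},
      K.IsRichTheoryModel A → K.IsRichTheoryModel B → K.IsStrongEmbedding h →
      IsElementaryMap L h := by
    intro A B _ _ h hA hB hh
    obtain ⟨e, rfl⟩ := hh.exists_embedding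
    have hr : K.IsRichTheoryModel e.toHom.range :=
      hA.of_equiv e.equivRange.toElementaryEmbedding.elementarilyEquivalent
    have hcomp : ofEmbedding e = (ofEmbedding e.equivRange.toEmbedding).trans
        (ofEmbedding e.toHom.range.subtype) := PEquiv.ext fun _ => rfl
    have hs : K.IsStrongSubmodel e.toHom.range := by
      have := K.comp (K.K2 (mor_of_equiv hA.1 e.equivRange)) hh.1
      unfold IsStrongSubmodel
      convert this using 1
      refine PEquiv.ext fun x => ?_
      obtain ⟨y, rfl⟩ := e.equivRange.surjective x
      rw [eq_comm]
      exact (PEquiv.trans_eq_some _ _ _ _).2 ⟨y, (PEquiv.eq_some_iff _).2 rfl, rfl⟩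
    have hel := (hsub B _ hr hB).1 hs
    rw [hcomp]
    refine (isElementaryMap_of_equiv _).trans ?_
    exact isElementaryMap_ofEmbedding (ElementarySubstructure.subtype ⟨_, hel⟩)
  obtain ⟨N', _, j, h, hj, hh, hle⟩ := K.Ap hf
  obtain ⟨V, _, k, hV, -, hk⟩ := exists_isRich_ge inaccessibles (K.obj_of_mor hj.1).2 ℵ₀
  have h1 := key hM hV.isRichTheoryModel (IsStrongEmbedding.trans hh hk)
  have h2 := key hN hV.isRichTheoryModel (IsStrongEmbedding.trans hj hk)
  refine (h1.trans h2.symm).mono (le_iff.2 fun a b hab => ?_)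
  have h3 := hj.2.apply b
  have h4 := hk.2.apply (hj.2.fn b)
  refine (PEquiv.trans_eq_some _ _ _ _).2 ⟨hk.2.fn (hj.2.fn b),
    (PEquiv.trans_eq_some _ _ _ _).2 ⟨_, le_iff.1 hle _ _
      ((PEquiv.trans_eq_some _ _ _ _).2 ⟨b, hab, h3⟩), h4⟩, (PEquiv.eq_some_iff _).2 ?_⟩
  exact (PEquiv.trans_eq_some _ _ _ _).2 ⟨_, h3, h4⟩

end InductiveAmalgamationClass

open InductiveAmalgamationClass

theorem theorem4p9 {L : FirstOrder.Language.{v, w}} [Countable L.Symbols]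
    (inaccessibles : ∀ κ : Cardinal.{u}, ∃ μ : Cardinal.{u}, κ < μ ∧ μ.IsInaccessible)
    (K : InductiveAmalgamationClass.{u, v, w} L) (hK : K.IsFull)
    (κ : Cardinal.{u}) (hκ : ℵ₀ ≤ κ) :
    List.TFAE [
      ∀ (U : Type u) [L.Structure U], K.IsRich U → IsSaturated L U,
      ∀ (U : Type u) [L.Structure U], K.IsRichAt κ U → IsSaturatedAt L κ U,
      ∀ (M : Type u) [L.Structure M], K.IsRichTheoryModel M → IsSaturated L M → K.IsRich M,
      ∀ (M N : Type u) [L.Structure M] [L.Structure N] (f : M ≃. N),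
        K.IsRichTheoryModel M → K.IsRichTheoryModel N → K.Mor f → PartialMap.IsElementaryMap L f,
      ∀ (N : Type u) [L.Structure N] (S : L.Substructure N),
        K.IsRichTheoryModel S → K.IsRichTheoryModel N →
          (K.IsStrongSubmodel S ↔ S.IsElementary)] := by
  tfae_have 1 → 4 := by
    intro h M N _ _ f hM hN hf
    have key : ∀ {A : Type u} [L.Structure A], K.IsRichTheoryModel A →
        K.IsFinitelyRichlyEmbeddable A := by
      intro A _ hA
      obtain ⟨U, _, hU, hAU⟩ := hK.exists_isRich_equiv hA
      exact isFinitelyRichlyEmbeddable_of_isSaturatedAt hU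
        (IsSaturatedAt.mono (h U hU) hU.aleph0_le) hAU
    exact isElementaryMap_of_isFinitelyRichlyEmbeddable (key hM) (key hN) hf
  tfae_have 2 → 4 := by
    intro h M N _ _ f hM hN hf
    have key : ∀ {A : Type u} [L.Structure A], K.IsRichTheoryModel A →
        K.IsFinitelyRichlyEmbeddable A := by
      intro A _ hA
      obtain ⟨U, _, hU, hAU⟩ := hK.exists_isRich_equiv hA
      -- The rich model given by fullness may be smaller than `κ` and so need not be `κ`-rich. A
      -- larger rich extension is `κ`-rich and has the same theory.
      obtain ⟨V, _, j, hV, hκV, hj⟩ := exists_isRich_ge inaccessibles hU.1 κ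
      have hUV := IsRichAt.isElementaryMap hU.aleph0_le hV.aleph0_le hU hV hj.1
      exact isFinitelyRichlyEmbeddable_of_isSaturatedAt hV
        ((h V (IsRichAt.mono hV hκV)).mono hκ) (hAU.trans hUV.elementarilyEquivalent)
    exact isElementaryMap_of_isFinitelyRichlyEmbeddable (key hM) (key hN) hf
  tfae_have 3 → 4 := fun h M N _ _ f hM hN hf =>
    isElementaryMap_of_isFinitelyRichlyEmbeddable
      (isFinitelyRichlyEmbeddable_of_forall_isRich inaccessibles h hM)
      (isFinitelyRichlyEmbeddable_of_forall_isRich inaccessibles h hN) hf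
  tfae_have 4 → 1 := fun h U _ hU =>
    IsRichAt.isSaturatedAt_of_forall_isElementaryMap inaccessibles h hU.aleph0_le hU
  tfae_have 4 → 2 := fun h U _ hU =>
    IsRichAt.isSaturatedAt_of_forall_isElementaryMap inaccessibles h hκ hU
  tfae_have 4 → 3 := fun h M _ hM hsat => isRich_of_isSaturated inaccessibles h hM hsat
  tfae_have 4 → 5 := by
    intro h N _ S hS hN
    constructor
    · intro hmor n φ a
      exact (h S N _ hS hN hmor n φ a (fun i => a i) fun i => rfl).symm
    · intro hel
      exact K.K1 hS.1 hN.1 (isElementaryMap_ofEmbedding (ElementarySubstructure.subtype ⟨S, hel⟩))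
  tfae_have 5 → 4 := fun h M N _ _ f hM hN hf =>
    isElementaryMap_of_isStrongSubmodel_iff inaccessibles h hM hN hf
  tfae_finish
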